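/- Let $T$ be an infinite, locally finite tree with graph distance $d$, and fix a boundary point $\omega_*\in\partial T$ (an equivalence class of semi-infinite geodesics). Write $x\le y$ if $y$ lies on the semi-infinite geodesic from $x$ to $\omega_*$; each $x\in T$ has exactly one neighbour $\mathfrak p(x)$ (its predecessor) lying above $x$, and the remaining neighbours form the set $\mathrm{succ}(x)$ of its successors. A level function is a map $\ell(x)=\lim_{j\to\infty}\,(j-d(x,x_j))$, where $(x_j)_{j\ge0}$ is a semi-infinite geodesic with endpoint $\omega_*$. A flow measure is a function $m:T\to(0,\infty)$ with $m(x)=\sum_{y\in \mathrm{succ}(x)}m(y)$ for all $x\in T$; it is identified with the measure on $T$ with density $m$ with respect to the counting measure, and $(T,m)$ is then called a flow tree. On $L^2(m)$ let $\nabla f(x)=f(x)-f(\mathfrak p(x))$, let $\nabla^*$ be its adjoint, and let $\mathcal L=\frac12\nabla^*\nabla$ be the flow Laplacian. For a bounded operator $\mathcal O$ on $L^2(m)$, $K_{\mathcal O}:T\times T\to\mathbb C$ denotes its integral kernel, so that $\mathcal Of(x)=\sum_{y\in T}K_{\mathcal O}(x,y)f(y)m(y)$ for all finitely supported $f$. **Theorem.**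 For every $\varepsilon>0$ there is a constant $c_\varepsilon>0$ such that, for every flow tree $(T,m)$ and every $t\ge1$, \begin{align*} \sup_{y\in T}\sum_{x\in T}e^{\varepsilon d(x,y)/\sqrt t}\,|K_{e^{-t\mathcal L}}(x,y)|\,m(x)&\le c_\varepsilon,\\ \sup_{y\in T}\sum_{x\in T}e^{\varepsilon d(x,y)/\sqrt t}\,|K_{\nabla e^{-t\mathcal L}}(x,y)|\,m(x)&\le \frac{c_\varepsilon}{\sqrt t},\\ \sup_{y\in T}\sum_{x\in T}e^{\varepsilon d(x,y)/\sqrt t}\,|K_{e^{-t\mathcal L}\nabla^*}(x,y)|\,m(x)&\le \frac{c_\varepsilon}{\sqrt t},\\ \sup_{y\in T}\sum_{x\in T}e^{\varepsilon d(x,y)/\sqrt t}\,|K_{\nabla e^{-t\mathcal L}\nabla^*}(x,y)|\,m(x)&\le \frac{c_\varepsilon}{t}. \end{align*} Moreover, there is a constant $C>0$ such that, for every flow tree $(T,m)$ with level function $\ell$ and every $t>0$, \begin{align*} \sup_{l\in\mathbb Z}\sup_{x\in T}\sum_{z\in T:\,\ell(z)=l}|K_{\nabla e^{-t\mathcal L}}(x,z)|\,m(z)&\le\frac{C}{1+t},\\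 \sup_{l\in\mathbb Z}\sup_{x\in T}\sum_{z\in T:\,\ell(z)=l}|K_{\nabla e^{-t\mathcal L}}(z,x)|\,m(z)&\le\frac{C}{1+t}. \end{align*} -/

import Mathlib

open Filter Topology MeasureTheory
open scoped ENNReal

noncomputable section

namespace FlowTrees

variable {T : Type*}

/-- A semi-infinite geodesic `x₀, x₁, x₂, …` in a graph. -/
structure GeodesicRay (G : SimpleGraph T) where
  vertex : ℕ → T
  dist_eq : ∀ i j, i ≤ j → G.dist (vertex i) (vertex j) = j - i

/-- Two rays are equivalent when they coincide from some point on, up to a shift of the index. -/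
def GeodesicRay.setoid (G : SimpleGraph T) : Setoid (GeodesicRay G) where
  r r s := ∃ n m, ∀ k, r.vertex (k + n) = s.vertex (k + m)
  iseqv :=
    { refl := fun _ => ⟨0, 0, fun _ => rfl⟩
      symm := fun ⟨n, m, h⟩ => ⟨m, n, fun k => (h k).symm⟩
      trans := by
        rintro r s u ⟨n, m, h⟩ ⟨n', m', h'⟩
        refine ⟨n' + n, m + m', fun k => ?_⟩
        have h1 := h (k + n')
        have h2 := h' (k + m)
        rw [← add_assoc, h1, ← add_assoc, ← h2]
        congr 1
        omega }

/-- The boundary at infinity `∂T`: equivalence classes of semi-infinite geodesics. -/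
def Boundary (G : SimpleGraph T) : Type _ := Quotient (GeodesicRay.setoid G)

/-- The boundary point that is the endpoint at infinity of a semi-infinite geodesic. -/
def GeodesicRay.endpoint {G : SimpleGraph T} (r : GeodesicRay G) : Boundary G :=
  Quotient.mk (GeodesicRay.setoid G) r

/-- A locally finite tree with vertex set `T` and with a chosen boundary point as its root.
(The tree is infinite, since it contains a semi-infinite geodesic.) -/
structure RootedTree (T : Type*) where
  graph : SimpleGraph T
  isTree : graph.IsTree
  locallyFinite : ∀ x, (graph.neighborSet x).Finite
  root : Boundary graph

namespace RootedTree

variable (R : RootedTree T)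

/-- The partial order: `x ≤ y` if `y` lies on the semi-infinite geodesic from `x` to the root. -/
def le (x y : T) : Prop :=
  ∃ r : GeodesicRay R.graph, r.vertex 0 = x ∧ r.endpoint = R.root ∧ ∃ k, r.vertex k = y

theorem exists_ray (x : T) :
    ∃ r : GeodesicRay R.graph, r.vertex 0 = x ∧ r.endpoint = R.root := by
  obtain ⟨r, hr⟩ := Quotient.exists_rep R.root
  have hc := R.isTree.connected
  -- choose `j₀` minimising `d(x, r j) - j` (shifted to be a natural number)
  have hlow : ∀ j, j ≤ R.graph.dist x (r.vertex j) + R.graph.dist x (r.vertex 0) := by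
    intro j
    have h1 := hc.dist_triangle (u := r.vertex 0) (v := x) (w := r.vertex j)
    rw [r.dist_eq 0 j (Nat.zero_le _), SimpleGraph.dist_comm (u := r.vertex 0)] at h1
    omega
  obtain ⟨j₀, hj₀⟩ : ∃ j₀, ∀ j, R.graph.dist x (r.vertex j₀) + j ≤
      R.graph.dist x (r.vertex j) + j₀ := by
    let f : ℕ → ℕ := fun j => R.graph.dist x (r.vertex j) + R.graph.dist x (r.vertex 0) - j
    refine ⟨Function.argmin f, fun j => ?_⟩
    have h1 : f (Function.argmin f) ≤ f j := Function.argmin_le f j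
    have h2 := hlow j
    have h3 := hlow (Function.argmin f)
    simp only [f] at h1 h2 h3 ⊢
    omega
  have hge : ∀ j, j₀ ≤ j →
      R.graph.dist x (r.vertex j) = R.graph.dist x (r.vertex j₀) + (j - j₀) := by
    intro j hj
    have h1 := hc.dist_triangle (u := x) (v := r.vertex j₀) (w := r.vertex j)
    rw [r.dist_eq j₀ j hj] at h1
    have := hj₀ j
    omega
  obtain ⟨p, hp⟩ := hc.exists_walk_length_eq_dist x (r.vertex j₀)
  set D := R.graph.dist x (r.vertex j₀) with hD
  let v : ℕ → T := fun k => if k ≤ D then p.getVert k else r.vertex (j₀ + (k - D))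
  have hv0 : v 0 = x := by simp [v]
  have hvD : ∀ k, v (D + k) = r.vertex (j₀ + k) := by
    intro k
    rcases Nat.eq_zero_or_pos k with rfl | hk
    · simp [v, ← hp]
    · have : ¬ (D + k ≤ D) := by omega
      simp [v, this]
  have hadj : ∀ k, R.graph.Adj (v k) (v (k + 1)) := by
    intro k
    rcases lt_or_ge k D with hk | hk
    · have h1 : k ≤ D := hk.le
      have h2 : k + 1 ≤ D := hk
      simp only [v, h1, h2, if_true]
      exact p.adj_getVert_succ (by omega)
    · obtain ⟨c, rfl⟩ := Nat.exists_eq_add_of_le hk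
      rw [add_assoc, hvD, hvD, ← SimpleGraph.dist_eq_one_iff_adj, r.dist_eq _ _ (by omega)]
      omega
  have hle : ∀ i k, R.graph.dist (v i) (v (i + k)) ≤ k := by
    intro i k
    induction k with
    | zero => simp
    | succ k ih =>
      have h1 := hc.dist_triangle (u := v i) (v := v (i + k)) (w := v (i + (k + 1)))
      have h2 := SimpleGraph.dist_eq_one_iff_adj.mpr (hadj (i + k))
      rw [add_assoc] at h2
      omega
  have hx : ∀ k, R.graph.dist x (v k) = k := by
    intro k
    have h1 := hle 0 k
    have h2 := hle k D
    rw [hv0, Nat.zero_add] at h1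
    have h3 := hge (j₀ + k) (by omega)
    rw [← hvD k, add_comm D k] at h3
    have h4 := hc.dist_triangle (u := x) (v := v k) (w := v (k + D))
    omega
  refine ⟨⟨v, ?_⟩, hv0, ?_⟩
  · intro i j hij
    obtain ⟨c, rfl⟩ := Nat.exists_eq_add_of_le hij
    have h1 := hle i c
    have h2 := hc.dist_triangle (u := x) (v := v i) (w := v (i + c))
    rw [hx, hx] at h2
    omega
  · rw [← hr]
    exact Quotient.sound ⟨D, j₀, fun k => by
      change v (k + D) = _
      rw [add_comm k D, hvD, add_comm]⟩

theorem closer_unique {x y y' z : T} (h : R.graph.Adj x y) (h' : R.graph.Adj x y')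
    (hy : R.graph.dist y z < R.graph.dist x z) (hy' : R.graph.dist y' z < R.graph.dist x z) :
    y = y' := by
  have hc := R.isTree.connected
  obtain ⟨p, hp⟩ := hc.exists_walk_length_eq_dist y z
  obtain ⟨p', hp'⟩ := hc.exists_walk_length_eq_dist y' z
  have key : ∀ {w : T} (hw : R.graph.Adj x w) (q : R.graph.Walk w z),
      q.length = R.graph.dist w z → R.graph.dist w z < R.graph.dist x z →
      (SimpleGraph.Walk.cons hw q).IsPath := by
    intro w hw q hq hlt
    apply SimpleGraph.Walk.isPath_of_length_eq_dist
    have := SimpleGraph.dist_le (SimpleGraph.Walk.cons hw q)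
    rw [SimpleGraph.Walk.length_cons] at this ⊢
    omega
  have := (R.isTree.existsUnique_path x z).unique (key h p hp hy) (key h' p' hp' hy')
  have h2 := congrArg (fun q : R.graph.Walk x z => q.getVert 1) this
  simpa using h2

theorem ray_unique {r s : GeodesicRay R.graph} (h0 : r.vertex 0 = s.vertex 0)
    (h : r.endpoint = s.endpoint) : r.vertex 1 = s.vertex 1 := by
  obtain ⟨n, m, hnm⟩ : ∃ n m, ∀ k, r.vertex (k + n) = s.vertex (k + m) := Quotient.exact h
  have hd : n = m := by
    have h1 := r.dist_eq 0 (0 + n) (Nat.zero_le _)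
    have h2 := s.dist_eq 0 (0 + m) (Nat.zero_le _)
    rw [hnm 0, h0, h2] at h1
    omega
  subst hd
  have e := hnm 2
  refine R.closer_unique (x := r.vertex 0) (z := r.vertex (2 + n)) ?_ ?_ ?_ ?_
  · exact SimpleGraph.dist_eq_one_iff_adj.mp (r.dist_eq 0 1 (by omega))
  · rw [h0]
    exact SimpleGraph.dist_eq_one_iff_adj.mp (s.dist_eq 0 1 (by omega))
  · rw [r.dist_eq 0 _ (by omega), r.dist_eq 1 _ (by omega)]
    omega
  · rw [r.dist_eq 0 _ (by omega), e, s.dist_eq 1 _ (by omega)]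
    omega

theorem eq_vertex_one {x y : T} (h : R.graph.Adj x y) {r : GeodesicRay R.graph}
    (h0 : r.vertex 0 = x) (hk : ∃ k, r.vertex k = y) : y = r.vertex 1 := by
  obtain ⟨k, rfl⟩ := hk
  have h1 := SimpleGraph.dist_eq_one_iff_adj.mpr h
  rw [← h0, r.dist_eq 0 k (Nat.zero_le _)] at h1
  have : k = 1 := by omega
  rw [this]

/-- Every vertex has exactly one neighbour lying above it. -/
theorem existsUnique_above (x : T) : ∃! y, R.graph.Adj x y ∧ R.le x y := by
  obtain ⟨r, h0, hr⟩ := R.exists_ray x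
  refine ⟨r.vertex 1, ⟨?_, r, h0, hr, 1, rfl⟩, ?_⟩
  · rw [← h0]
    exact SimpleGraph.dist_eq_one_iff_adj.mp (r.dist_eq 0 1 (by omega))
  · rintro y ⟨hy, s, s0, hs, hk⟩
    rw [R.eq_vertex_one hy s0 hk]
    exact R.ray_unique (s0.trans h0.symm) (hs.trans hr.symm)

/-- The predecessor `𝔭(x)`: the only neighbour of `x` lying above `x`. -/
def pred (x : T) : T := (R.existsUnique_above x).choose

/-- The set of successors of `x`: the neighbours of `x` other than its predecessor. -/
def succ (x : T) : Set T := {y | R.graph.Adj x y ∧ y ≠ R.pred x}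

theorem pred_eq_of_ray {x : T} {r : GeodesicRay R.graph} (h0 : r.vertex 0 = x)
    (hr : r.endpoint = R.root) : R.pred x = r.vertex 1 := by
  obtain ⟨h1, s, s0, hs, hk⟩ := (R.existsUnique_above x).choose_spec.1
  exact (R.eq_vertex_one h1 s0 hk).trans (R.ray_unique (s0.trans h0.symm) (hs.trans hr.symm))

/-- `y` is a successor of `x` exactly when `x` is the predecessor of `y`. -/
theorem mem_succ_iff {x y : T} : y ∈ R.succ x ↔ R.pred y = x := by
  constructor
  · rintro ⟨hadj, hne⟩
    obtain ⟨r, h0, hr⟩ := R.exists_ray x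
    have hp := R.pred_eq_of_ray h0 hr
    have hd : ∀ k, R.graph.dist y (r.vertex k) = k + 1 := by
      intro k
      have hxk : R.graph.dist x (r.vertex k) = k := by
        rw [← h0, r.dist_eq 0 k (Nat.zero_le _)]; rfl
      rcases R.isTree.dist_eq_dist_add_one_of_adj (r.vertex k) hadj with h | h <;>
        rw [SimpleGraph.dist_comm (u := r.vertex k) (v := x),
          SimpleGraph.dist_comm (u := r.vertex k) (v := y), hxk] at h
      · exfalso
        apply hne
        rw [hp]
        refine R.closer_unique (x := x) (z := r.vertex k) hadj ?_ ?_ ?_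
        · rw [← h0]
          exact SimpleGraph.dist_eq_one_iff_adj.mp (r.dist_eq 0 1 (by omega))
        · omega
        · rw [hxk, r.dist_eq 1 k (by omega)]
          omega
      · exact h
    let v : ℕ → T := fun k => Nat.casesOn k y r.vertex
    let s : GeodesicRay R.graph := ⟨v, by
      intro i j hij
      rcases i with _ | i <;> rcases j with _ | j
      · simp [v]
      · exact hd j
      · omega
      · change R.graph.dist (r.vertex i) (r.vertex j) = _
        rw [r.dist_eq i j (by omega)]
        omega⟩
    have hs : s.endpoint = R.root := by
      rw [← hr]
      exact Quotient.sound ⟨1, 0, fun _ => rfl⟩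
    rw [R.pred_eq_of_ray (x := y) (r := s) rfl hs]
    exact h0
  · rintro rfl
    obtain ⟨r, h0, hr⟩ := R.exists_ray y
    have hp := R.pred_eq_of_ray h0 hr
    let s : GeodesicRay R.graph := ⟨fun k => r.vertex (k + 1), by
      intro i j hij
      rw [r.dist_eq _ _ (by omega)]
      omega⟩
    have hs : s.endpoint = R.root := by
      rw [← hr]
      exact Quotient.sound ⟨0, 1, fun _ => rfl⟩
    refine ⟨?_, ?_⟩
    · rw [hp, ← h0]
      exact (SimpleGraph.dist_eq_one_iff_adj.mp (r.dist_eq 0 1 (by omega))).symm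
    · rw [R.pred_eq_of_ray (x := R.pred y) (r := s) hp.symm hs, ← h0]
      intro h
      have h2 := r.dist_eq 0 2 (by omega)
      change r.vertex 0 = r.vertex 2 at h
      rw [← h, SimpleGraph.dist_self] at h2
      omega

/-- `ℓ` is a level function of the tree: for some semi-infinite geodesic `(x_j)` ending at the root,
`ℓ(x) = lim_j (j - d(x, x_j))` for every vertex `x`. -/
def IsLevelFunction (ℓ : T → ℤ) : Prop :=
  ∃ r : GeodesicRay R.graph, r.endpoint = R.root ∧
    ∀ x, Tendsto (fun j : ℕ => (j : ℤ) - R.graph.dist x (r.vertex j)) atTop (𝓝 (ℓ x))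

end RootedTree

/-- A flow tree: a tree with root at infinity and a positive function `m` on its vertices whose
value at each `x` is the sum of its values at the (finitely many) successors of `x`. -/
structure FlowTree (T : Type*) extends RootedTree T where
  m : T → ℝ
  m_pos : ∀ x, 0 < m x
  flow : ∀ x, m x = ∑ᶠ y ∈ toRootedTree.succ x, m y

namespace FlowTree

variable [MeasurableSpace T] [DiscreteMeasurableSpace T] (F : FlowTree T)

/-- The flow measure: the measure with density `m` with respect to the counting measure. -/
def measure : Measure T := Measure.count.withDensity fun x => ENNReal.ofReal (F.m x)

theorem measure_apply (s : Set T) : F.measure s = ∑' x : s, ENNReal.ofReal (F.m x) := by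
  rw [measure, withDensity_apply _ (MeasurableSet.of_discrete), ← lintegral_indicator
    (MeasurableSet.of_discrete), lintegral_count, tsum_subtype s fun x => ENNReal.ofReal (F.m x)]

theorem measure_singleton (x : T) : F.measure {x} = ENNReal.ofReal (F.m x) := by
  rw [measure_apply, tsum_singleton x fun x => ENNReal.ofReal (F.m x)]

/-- The predecessor map preserves the flow measure. -/
theorem measurePreserving_pred : MeasurePreserving F.pred F.measure F.measure := by
  refine ⟨Measurable.of_discrete, ?_⟩
  have hfib : ∀ x, ∑' y : F.pred ⁻¹' {x}, ENNReal.ofReal (F.m y) = ENNReal.ofReal (F.m x) := by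
    intro x
    have hs : F.pred ⁻¹' {x} = F.succ x := by
      ext y
      exact F.mem_succ_iff.symm
    have hfin : (F.succ x).Finite := (F.locallyFinite x).subset fun y hy => hy.1
    rw [hs, F.flow x, finsum_mem_eq_finite_toFinset_sum _ hfin,
      ENNReal.ofReal_sum_of_nonneg fun y _ => (F.m_pos y).le,
      tsum_subtype (F.succ x) fun y => ENNReal.ofReal (F.m y), tsum_eq_sum (s := hfin.toFinset)]
    · refine Finset.sum_congr rfl fun y hy => ?_
      rw [Set.indicator_of_mem (hfin.mem_toFinset.mp hy)]
    · intro y hy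
      rw [Set.indicator_of_notMem]
      simpa using hy
  ext s hs
  rw [Measure.map_apply Measurable.of_discrete hs, measure_apply, measure_apply,
    tsum_subtype (F.pred ⁻¹' s) fun y => ENNReal.ofReal (F.m y),
    tsum_subtype s fun y => ENNReal.ofReal (F.m y), ← ENNReal.tsum_fiberwise _ F.pred]
  refine tsum_congr fun x => ?_
  by_cases hx : x ∈ s
  · rw [Set.indicator_of_mem hx, ← hfib x]
    refine tsum_congr fun y => ?_
    have hy : F.pred y = x := y.2
    rw [Set.indicator_of_mem]
    rw [Set.mem_preimage, hy]
    exact hx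
  · rw [Set.indicator_of_notMem hx, ENNReal.tsum_eq_zero]
    intro y
    have hy : F.pred y = x := y.2
    rw [Set.indicator_of_notMem]
    rw [Set.mem_preimage, hy]
    exact hx

/-- The Hilbert space `L²(m)` of complex-valued functions on `T`. -/
abbrev L2 : Type _ := Lp ℂ 2 F.measure

/-- The shift operator `Σ f = f ∘ 𝔭` on `L²(m)`. -/
def shift : F.L2 →L[ℂ] F.L2 :=
  (Lp.compMeasurePreservingₗᵢ ℂ F.pred F.measurePreserving_pred).toContinuousLinearMap

/-- The flow gradient `∇ = I - Σ`, i.e. `∇f(x) = f(x) - f(𝔭(x))`, on `L²(m)`. -/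
def gradient : F.L2 →L[ℂ] F.L2 := 1 - F.shift

/-- The adjoint `∇*` of the flow gradient on `L²(m)`. -/
def gradientAdj : F.L2 →L[ℂ] F.L2 := ContinuousLinearMap.adjoint F.gradient

/-- The flow Laplacian `ℒ = ½ ∇*∇`. -/
def laplacian : F.L2 →L[ℂ] F.L2 := (1 / 2 : ℂ) • (F.gradientAdj * F.gradient)

/-- The heat semigroup `e^{-tℒ}` (exponential of a bounded operator on `L²(m)`). -/
def heat (t : ℝ) : F.L2 →L[ℂ] F.L2 := NormedSpace.exp (-(t : ℂ) • F.laplacian)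

theorem measure_singleton_ne_top (y : T) : F.measure {y} ≠ ∞ := by
  rw [measure_singleton]
  exact ENNReal.ofReal_ne_top

/-- The integral kernel of an operator `O` on `L²(m)` with respect to `m`, that is, the function
`K` such that `O f (x) = ∑ y, K(x,y) f(y) m(y)` for all finitely supported `f`;
taking for `f` the characteristic function of `{y}` gives `K(x,y) = (O 1_{y})(x) / m(y)`.
(Points have positive measure, so an element of `L²(m)` has a well-defined value at each `x`.) -/
def kernel (O : F.L2 →L[ℂ] F.L2) (x y : T) : ℂ :=
  (O (indicatorConstLp 2 (MeasurableSet.of_discrete (s := {y})) (F.measure_singleton_ne_top y)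
    (1 : ℂ)) : T → ℂ) x / (F.m y : ℂ)

/-- The sum `∑_x e^{ε d(x,y)/√t} |K(x,y)| m(x)`, as an element of `[0,∞]`. -/
def weightedSum (ε t : ℝ) (K : T → T → ℂ) (y : T) : ℝ≥0∞ :=
  ∑' x, ENNReal.ofReal (Real.exp (ε * F.graph.dist x y / √t) * ‖K x y‖ * F.m x)

end FlowTree

end FlowTrees

end

/-!
The shift `Σ` is an isometry, so `Σ*Σ = 1` and `ℒ = 1 - (Σ + Σ*)/2`. By the relation `Σ*Σ = 1` the
Chebyshev polynomials of the second kind satisfy `U_n((Σ + Σ*)/2) = ∑_{a+b=n} Σᵃ(Σ*)ᵇ`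
(`FlowTree.cheb_natCast`), and the power series of the exponential becomes
`e^{-tℒ} = ∑_{i,j} p_i p_j U_{i-j}((Σ + Σ*)/2)` with `p` the Poisson weights of parameter `t/2`. As
`U_{-n-2} = -U_n`, this gives `e^{-tℒ} = ∑_{a,b} h_{a+b} Σᵃ(Σ*)ᵇ` (`FlowTree.hasSum_heat`), where
`h_k = g_k - g_{k+2}` and `g` is the distribution of the difference of two independent Poisson
variables. Multiplying by `∇ = 1 - Σ` on the left or by `∇* = 1 - Σ*` on the right takes differences
of the coefficients in `a` or in `b`, up to boundary terms at `a = 0` or `b = 0`.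

The kernel of `Σᵃ(Σ*)ᵇ` is `1/m(𝔭ᵇ y)` if `𝔭ᵃ x = 𝔭ᵇ y` and `0` otherwise: it is nonnegative, has
mass one in each variable because `𝔭` preserves the flow measure, and forces `d(x, y) ≤ a + b` and
`ℓ(x) + a = ℓ(y) + b`. Hence all the sums in the theorem are dominated by sums of the coefficients,
with weights `e^{ε(a+b)/√t}` (`FlowTree.weightedSum_kernel_le`) or along the diagonals
`a - b = const` (`FlowTree.tsum_level_right_le`, `FlowTree.tsum_level_left_le`), independently of
the tree.

What remains is that the `j`-th differences of `g` are `O(t^{-j/2})` in `ℓ¹` with weight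
`e^{αk/√t}`, for `j = 1, 2, 3` (`tsum_enorm_corrDiff_le`). In the convolution algebra of power
series, the Poisson weights of parameter `t/2` are the `j`-fold convolution of those of parameter
`t/(2j)`, so one difference falls on each factor, and one difference of Poisson weights is estimated
by the second moment of the distribution (`wnorm_one_sub_X_mul_poisson_le`). The factor `n + 1`
from the number of words of length `n` costs `√t`, and `h` is already a difference of `g`.
-/

noncomputable section

namespace FlowTrees

/-! ### Trees with a root at infinity -/

namespace RootedTree

variable {T : Type*} (R : RootedTree T)

theorem adj_pred (x : T) : R.graph.Adj x (R.pred x) :=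
  (R.existsUnique_above x).choose_spec.1.1

theorem dist_iterate_pred_le (x : T) (n : ℕ) : R.graph.dist x (R.pred^[n] x) ≤ n := by
  induction n with
  | zero => simp
  | succ n ih =>
    rw [Function.iterate_succ_apply']
    have h1 := R.isTree.connected.dist_triangle (u := x) (v := R.pred^[n] x)
      (w := R.pred (R.pred^[n] x))
    have h2 := SimpleGraph.dist_eq_one_iff_adj.mpr (R.adj_pred (R.pred^[n] x))
    omega

theorem dist_le_of_iterate_pred_eq {x y : T} {a b : ℕ} (h : R.pred^[a] x = R.pred^[b] y) :
    R.graph.dist x y ≤ a + b := by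
  have h1 := R.isTree.connected.dist_triangle (u := x) (v := R.pred^[a] x) (w := y)
  have h2 := R.dist_iterate_pred_le x a
  have h3 := R.dist_iterate_pred_le y b
  rw [SimpleGraph.dist_comm, ← h] at h3
  omega

variable {R} {ℓ : T → ℤ}

theorem IsLevelFunction.apply_pred (hℓ : R.IsLevelFunction ℓ) (x : T) :
    ℓ (R.pred x) = ℓ x + 1 := by
  obtain ⟨r, hr, hlim⟩ := hℓ
  obtain ⟨s, s0, hs⟩ := R.exists_ray x
  have hp : R.pred x = s.vertex 1 := R.pred_eq_of_ray s0 hs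
  obtain ⟨n, m, hnm⟩ : ∃ n m, ∀ k, s.vertex (k + n) = r.vertex (k + m) :=
    Quotient.exact (hs.trans hr.symm)
  have hx : ℓ x = m - n := by
    refine tendsto_nhds_unique (hlim x) (tendsto_const_nhds.congr' ?_)
    filter_upwards [eventually_ge_atTop m] with j hj
    obtain ⟨k, rfl⟩ := Nat.exists_eq_add_of_le' hj
    rw [← hnm, ← s0, s.dist_eq 0 _ (Nat.zero_le _)]
    omega
  have hpx : ℓ (R.pred x) = m - n + 1 := by
    refine tendsto_nhds_unique (hlim _) (tendsto_const_nhds.congr' ?_)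
    filter_upwards [eventually_ge_atTop (m + 1)] with j hj
    obtain ⟨k, rfl⟩ := Nat.exists_eq_add_of_le' hj
    rw [← add_assoc, add_right_comm, ← hnm, hp, s.dist_eq 1 _ (by omega)]
    omega
  rw [hpx, hx]

theorem IsLevelFunction.apply_iterate_pred (hℓ : R.IsLevelFunction ℓ) (x : T) (n : ℕ) :
    ℓ (R.pred^[n] x) = ℓ x + n := by
  induction n with
  | zero => simp
  | succ n ih =>
    rw [Function.iterate_succ_apply', hℓ.apply_pred, ih]
    push_cast
    ring

end RootedTree

namespace FlowTree

variable {T : Type*} (F : FlowTree T)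

/-! ### The shift, point masses and integral kernels -/

/-- A sum over the level `ℓ = l` of a function dominated by a combination of functions of mass
one only involves those whose support meets the level. -/
theorem tsum_level_le {c : ℕ × ℕ → ℝ} {k : T → ℝ≥0∞} {w : ℕ × ℕ → T → ℝ≥0∞} {ℓ : T → ℤ}
    {l : ℤ} {P : ℕ × ℕ → Prop} (hk : ∀ z, k z ≤ ∑' p, ‖c p‖ₑ * w p z) (hmass : ∀ p, ∑' z, w p z = 1)
    (hsupp : ∀ p z, ℓ z = l → ¬ P p → w p z = 0) :
    ∑' z : {z // ℓ z = l}, k z ≤ ∑' p : {p // P p}, ‖c p‖ₑ := by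
  have key : ∀ p, ∑' z : {z // ℓ z = l}, ‖c p‖ₑ * w p z ≤
      Set.indicator {p | P p} (fun p => ‖c p‖ₑ) p := by
    intro p
    rw [ENNReal.tsum_mul_left]
    by_cases hp : P p
    · rw [Set.indicator_of_mem (by exact hp)]
      refine mul_le_of_le_one_right' ?_
      rw [← hmass p]
      exact ENNReal.tsum_comp_le_tsum_of_injective Subtype.val_injective (w p)
    · refine le_of_eq_of_le (mul_eq_zero_of_right _ ?_) zero_le
      exact ENNReal.tsum_eq_zero.mpr fun z => hsupp p z z.2 hp
  calc _ ≤ ∑' z : {z // ℓ z = l}, ∑' p, ‖c p‖ₑ * w p z := ENNReal.tsum_le_tsum fun z => hk z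
    _ ≤ _ := by
        rw [ENNReal.tsum_comm]
        refine (ENNReal.tsum_le_tsum key).trans_eq ?_
        rw [← tsum_subtype]
        rfl

theorem m_ne_zero (x : T) : (F.m x : ℂ) ≠ 0 :=
  Complex.ofReal_ne_zero.mpr (F.m_pos x).ne'

theorem ofReal_m_inv_mul (x : T) : ENNReal.ofReal (F.m x)⁻¹ * ENNReal.ofReal (F.m x) = 1 := by
  rw [← ENNReal.ofReal_mul (inv_nonneg.mpr (F.m_pos x).le), inv_mul_cancel₀ (F.m_pos x).ne',
    ENNReal.ofReal_one]

variable [MeasurableSpace T] [DiscreteMeasurableSpace T]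

/-- Points have positive mass, so elements of `L²(m)` are equal as soon as they are equal almost
everywhere. -/
theorem eq_of_ae_eq {f g : T → ℂ} (h : f =ᵐ[F.measure] g) : f = g := by
  funext x
  by_contra hx
  have h0 : F.measure {x} = 0 := measure_mono_null (by simpa using hx) (ae_iff.mp h)
  rw [measure_singleton, ENNReal.ofReal_eq_zero] at h0
  exact absurd h0 (not_le.mpr (F.m_pos x))

/-- The normalised point mass `1_{y} / m(y)`, as an element of `L²(m)`. -/
def delta (y : T) : F.L2 :=
  (F.m y : ℂ)⁻¹ • indicatorConstLp 2 (MeasurableSet.of_discrete (s := {y}))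
    (F.measure_singleton_ne_top y) (1 : ℂ)

theorem inner_delta (y : T) (f : F.L2) : inner ℂ (F.delta y) f = (f : T → ℂ) y := by
  rw [delta, inner_smul_left, L2.inner_indicatorConstLp_one, integral_singleton,
    measureReal_def, measure_singleton, ENNReal.toReal_ofReal (F.m_pos y).le, map_inv₀,
    Complex.conj_ofReal, Complex.real_smul, inv_mul_cancel_left₀ (F.m_ne_zero y)]

theorem kernel_eq_inner (O : F.L2 →L[ℂ] F.L2) (x y : T) :
    F.kernel O x y = inner ℂ (F.delta x) (O (F.delta y)) := by
  rw [kernel, delta.eq_def F y, map_smul, inner_smul_right, inner_delta, div_eq_inv_mul]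

theorem inner_delta_delta (x y : T) [Decidable (x = y)] :
    inner ℂ (F.delta x) (F.delta y) = if x = y then (F.m y : ℂ)⁻¹ else 0 := by
  classical
  rw [inner_delta]
  have h : ((F.delta y : F.L2) : T → ℂ) =
      fun z => (F.m y : ℂ)⁻¹ * Set.indicator {y} (fun _ => (1 : ℂ)) z := by
    refine F.eq_of_ae_eq ?_
    rw [delta]
    filter_upwards [Lp.coeFn_smul (F.m y : ℂ)⁻¹ (indicatorConstLp 2
      (MeasurableSet.of_discrete (s := {y})) (F.measure_singleton_ne_top y) (1 : ℂ)),
      indicatorConstLp_coeFn (p := 2) (hs := MeasurableSet.of_discrete (s := {y}))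
        (hμs := F.measure_singleton_ne_top y) (c := (1 : ℂ))] with z h1 h2
    rw [h1, Pi.smul_apply, h2, smul_eq_mul]
  rw [h]
  split_ifs with hxy
  · subst hxy; simp
  · simp [hxy]

theorem shift_apply (f : F.L2) (x : T) : (F.shift f : T → ℂ) x = (f : T → ℂ) (F.pred x) :=
  congrFun (F.eq_of_ae_eq (Lp.coeFn_compMeasurePreserving f F.measurePreserving_pred)) x

/-- The adjoint `Σ*` of the shift. -/
def shiftAdj : F.L2 →L[ℂ] F.L2 := ContinuousLinearMap.adjoint F.shift

/-- The adjoint shift moves a normalised point mass to the predecessor. -/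
theorem shiftAdj_delta (y : T) : F.shiftAdj (F.delta y) = F.delta (F.pred y) := by
  refine ext_inner_right ℂ fun f => ?_
  rw [shiftAdj, ContinuousLinearMap.adjoint_inner_left, inner_delta, inner_delta, shift_apply]

theorem shiftAdj_pow_delta (n : ℕ) (y : T) :
    (F.shiftAdj ^ n) (F.delta y) = F.delta (F.pred^[n] y) := by
  induction n with
  | zero => simp
  | succ n ih =>
    rw [pow_succ', mul_apply_eq_comp, ih, shiftAdj_delta,
      Function.iterate_succ_apply']

theorem inner_delta_shift_pow (n : ℕ) (x : T) (f : F.L2) :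
    inner ℂ (F.delta x) ((F.shift ^ n) f) = inner ℂ (F.delta (F.pred^[n] x)) f := by
  induction n generalizing x with
  | zero => simp
  | succ n ih =>
    rw [pow_succ', mul_apply_eq_comp, inner_delta, shift_apply, ← inner_delta, ih,
      Function.iterate_succ_apply]

theorem norm_shift_le : ‖F.shift‖ ≤ 1 := LinearIsometry.norm_toContinuousLinearMap_le _

theorem norm_shiftAdj_le : ‖F.shiftAdj‖ ≤ 1 := by
  rw [shiftAdj, LinearIsometryEquiv.norm_map]
  exact F.norm_shift_le

/-- The shift is an isometry. -/
theorem shiftAdj_mul_shift : F.shiftAdj * F.shift = 1 :=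
  ContinuousLinearMap.norm_map_iff_adjoint_comp_self F.shift |>.mp
    (Lp.compMeasurePreservingₗᵢ ℂ F.pred F.measurePreserving_pred).norm_map

theorem gradientAdj_eq : F.gradientAdj = 1 - F.shiftAdj := by
  rw [gradientAdj, gradient, map_sub, shiftAdj]
  congr 1
  exact ContinuousLinearMap.adjoint_id

/-- The reduced words `Σᵃ (Σ*)ᵇ`, indexed by `(a, b)`. -/
def word (p : ℕ × ℕ) : F.L2 →L[ℂ] F.L2 := F.shift ^ p.1 * F.shiftAdj ^ p.2

theorem norm_word_le (p : ℕ × ℕ) : ‖F.word p‖ ≤ 1 := by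
  have h : ∀ (A : F.L2 →L[ℂ] F.L2), ‖A‖ ≤ 1 → ∀ n : ℕ, ‖A ^ n‖ ≤ 1 := by
    intro A hA n
    rcases Nat.eq_zero_or_pos n with rfl | hn
    · rw [pow_zero]
      exact ContinuousLinearMap.norm_id_le
    · exact (norm_pow_le' A hn).trans (pow_le_one₀ (norm_nonneg _) hA)
  exact (norm_mul_le _ _).trans
    (mul_le_one₀ (h _ F.norm_shift_le _) (norm_nonneg _) (h _ F.norm_shiftAdj_le _))

theorem kernel_word [DecidableEq T] (p : ℕ × ℕ) (x y : T) :
    F.kernel (F.word p) x y =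
      if F.pred^[p.1] x = F.pred^[p.2] y then (F.m (F.pred^[p.2] y) : ℂ)⁻¹ else 0 := by
  rw [kernel_eq_inner, word, mul_apply_eq_comp, shiftAdj_pow_delta,
    inner_delta_shift_pow, inner_delta_delta]

theorem enorm_kernel_word [DecidableEq T] (p : ℕ × ℕ) (x y : T) :
    ‖F.kernel (F.word p) x y‖ₑ =
      if F.pred^[p.1] x = F.pred^[p.2] y then ENNReal.ofReal (F.m (F.pred^[p.2] y))⁻¹ else 0 := by
  rw [kernel_word]
  split_ifs
  · rw [← ofReal_norm, norm_inv, Complex.norm_real, Real.norm_of_nonneg (F.m_pos _).le]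
  · simp

/-- Flow measures give the same mass to `{u}` and to the set of `n`-th descendants of `u`. -/
theorem tsum_iterate_pred_eq [DecidableEq T] (n : ℕ) (u : T) :
    ∑' x, (if F.pred^[n] x = u then ENNReal.ofReal (F.m x) else 0) = ENNReal.ofReal (F.m u) := by
  have h := (F.measurePreserving_pred.iterate n).measure_preimage
    (s := {u}) (MeasurableSet.of_discrete).nullMeasurableSet
  rw [measure_singleton, measure_apply,
    tsum_subtype (F.pred^[n] ⁻¹' {u}) fun x => ENNReal.ofReal (F.m x)] at h
  rw [← h]
  refine tsum_congr fun x => ?_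
  by_cases hx : F.pred^[n] x = u <;> simp [hx]

theorem tsum_enorm_kernel_word_left (p : ℕ × ℕ) (y : T) :
    ∑' x, ‖F.kernel (F.word p) x y‖ₑ * ENNReal.ofReal (F.m x) = 1 := by
  classical
  simp_rw [enorm_kernel_word, ite_mul, zero_mul, ← mul_ite_zero, ENNReal.tsum_mul_left,
    tsum_iterate_pred_eq]
  exact F.ofReal_m_inv_mul _

theorem tsum_enorm_kernel_word_right (p : ℕ × ℕ) (x : T) :
    ∑' y, ‖F.kernel (F.word p) x y‖ₑ * ENNReal.ofReal (F.m y) = 1 := by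
  classical
  have h : ∀ y, ‖F.kernel (F.word p) x y‖ₑ * ENNReal.ofReal (F.m y) =
      ENNReal.ofReal (F.m (F.pred^[p.1] x))⁻¹ *
        (if F.pred^[p.2] y = F.pred^[p.1] x then ENNReal.ofReal (F.m y) else 0) := by
    intro y
    rw [enorm_kernel_word, mul_ite_zero, ite_zero_mul]
    by_cases hy : F.pred^[p.1] x = F.pred^[p.2] y
    · rw [if_pos hy, if_pos hy.symm, hy]
    · rw [if_neg hy, if_neg (Ne.symm hy)]
  simp_rw [h, ENNReal.tsum_mul_left, tsum_iterate_pred_eq]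
  exact F.ofReal_m_inv_mul _

variable {F} {O : F.L2 →L[ℂ] F.L2} {c : ℕ × ℕ → ℝ}

theorem enorm_kernel_le (h : HasSum (fun p => (c p : ℂ) • F.word p) O) (x y : T) :
    ‖F.kernel O x y‖ₑ ≤ ∑' p, ‖c p‖ₑ * ‖F.kernel (F.word p) x y‖ₑ := by
  have h1 : HasSum (fun p => (c p : ℂ) * F.kernel (F.word p) x y) (F.kernel O x y) := by
    have h2 := (h.mapL (ContinuousLinearMap.apply ℂ F.L2 (F.delta y))).mapL
      (innerSL ℂ (F.delta x))
    simpa [kernel_eq_inner, inner_smul_right] using h2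
  rw [← h1.tsum_eq]
  refine enorm_tsum_le_tsum_enorm.trans_eq (tsum_congr fun p => ?_)
  rw [enorm_mul]
  congr 1
  simp [← ofReal_norm]

theorem ofReal_norm_mul (k : ℂ) (x : ℝ) :
    ENNReal.ofReal (‖k‖ * x) = ‖k‖ₑ * ENNReal.ofReal x := by
  rw [ENNReal.ofReal_mul (norm_nonneg _), ofReal_norm]

/-- An exponentially weighted sum of the kernel of `∑ c(a,b) Σᵃ(Σ*)ᵇ` is controlled by the
corresponding weighted sum of the coefficients: the kernel of `Σᵃ(Σ*)ᵇ` is nonnegative, has total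
mass `1` in each variable and is supported where `d(x,y) ≤ a + b`. -/
theorem weightedSum_kernel_le (h : HasSum (fun p => (c p : ℂ) • F.word p) O) {ε : ℝ}
    (hε : 0 ≤ ε) (t : ℝ) (y : T) :
    F.weightedSum ε t (F.kernel O) y ≤
      ∑' p : ℕ × ℕ, ‖c p‖ₑ * ENNReal.ofReal (Real.exp (ε / √t)) ^ (p.1 + p.2) := by
  classical
  have key : ∀ (p : ℕ × ℕ) (x : T),
      ENNReal.ofReal (Real.exp (ε * F.graph.dist x y / √t)) * ‖F.kernel (F.word p) x y‖ₑ ≤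
        ENNReal.ofReal (Real.exp (ε / √t)) ^ (p.1 + p.2) * ‖F.kernel (F.word p) x y‖ₑ := by
    intro p x
    rw [enorm_kernel_word]
    split_ifs with hxy
    · gcongr
      rw [← ENNReal.ofReal_pow (Real.exp_pos _).le, ← Real.exp_nat_mul]
      refine ENNReal.ofReal_le_ofReal (Real.exp_le_exp.mpr ?_)
      rw [mul_div_assoc, mul_comm, div_mul_eq_mul_div, mul_comm, ← mul_div_assoc, mul_comm]
      have hd : ((F.graph.dist x y : ℕ) : ℝ) ≤ ((p.1 + p.2 : ℕ) : ℝ) :=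
        Nat.cast_le.mpr (F.dist_le_of_iterate_pred_eq hxy)
      gcongr
    · simp
  calc F.weightedSum ε t (F.kernel O) y
      = ∑' x, ENNReal.ofReal (Real.exp (ε * F.graph.dist x y / √t)) * ‖F.kernel O x y‖ₑ *
          ENNReal.ofReal (F.m x) := by
        refine tsum_congr fun x => ?_
        rw [mul_assoc, ENNReal.ofReal_mul (Real.exp_pos _).le, ofReal_norm_mul, mul_assoc]
    _ ≤ ∑' x, ∑' p : ℕ × ℕ, ‖c p‖ₑ * (ENNReal.ofReal (Real.exp (ε / √t)) ^ (p.1 + p.2) *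
          (‖F.kernel (F.word p) x y‖ₑ * ENNReal.ofReal (F.m x))) := by
        refine ENNReal.tsum_le_tsum fun x => ?_
        refine (mul_le_mul_left (mul_le_mul_right (enorm_kernel_le h x y) _) _).trans ?_
        rw [← ENNReal.tsum_mul_left, ← ENNReal.tsum_mul_right]
        refine ENNReal.tsum_le_tsum fun p => ?_
        rw [mul_left_comm, mul_assoc, ← mul_assoc (ENNReal.ofReal _ ^ _)]
        exact mul_le_mul_right (mul_le_mul_left (key p x) _) _
    _ = _ := by
        rw [ENNReal.tsum_comm]
        simp_rw [ENNReal.tsum_mul_left, tsum_enorm_kernel_word_left, mul_one]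

theorem ofReal_norm_kernel_mul_le (h : HasSum (fun p => (c p : ℂ) • F.word p) O) (x y z : T) :
    ENNReal.ofReal (‖F.kernel O x y‖ * F.m z) ≤
      ∑' p, ‖c p‖ₑ * (‖F.kernel (F.word p) x y‖ₑ * ENNReal.ofReal (F.m z)) := by
  rw [ofReal_norm_mul]
  refine (mul_le_mul_left (enorm_kernel_le h x y) _).trans_eq ?_
  rw [← ENNReal.tsum_mul_right]
  simp_rw [mul_assoc]

theorem kernel_word_eq_zero {ℓ : T → ℤ} (hℓ : F.IsLevelFunction ℓ) {p : ℕ × ℕ} {x y : T}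
    (h : ℓ x + p.1 ≠ ℓ y + p.2) : F.kernel (F.word p) x y = 0 := by
  classical
  rw [kernel_word, if_neg]
  intro hxy
  refine h ?_
  rw [← hℓ.apply_iterate_pred, ← hℓ.apply_iterate_pred, hxy]

/-- The kernel of `Σᵃ(Σ*)ᵇ` only sees pairs `(x, z)` with `ℓ(x) + a = ℓ(z) + b`, so that the sum of
the kernel of `∑ c(a,b) Σᵃ(Σ*)ᵇ` over a level involves the coefficients on one diagonal. -/
theorem tsum_level_right_le (h : HasSum (fun p => (c p : ℂ) • F.word p) O) {ℓ : T → ℤ}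
    (hℓ : F.IsLevelFunction ℓ) (l : ℤ) (x : T) :
    ∑' z : {z // ℓ z = l}, ENNReal.ofReal (‖F.kernel O x z‖ * F.m z) ≤
      ∑' p : {p : ℕ × ℕ // (p.1 : ℤ) - p.2 = l - ℓ x}, ‖c p‖ₑ := by
  refine tsum_level_le (k := fun z => ENNReal.ofReal (‖F.kernel O x z‖ * F.m z))
    (fun z => ofReal_norm_kernel_mul_le h x z z)
    (fun p => F.tsum_enorm_kernel_word_right p x) fun p z hz hp => ?_
  rw [kernel_word_eq_zero hℓ (by omega), enorm_zero, zero_mul]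

theorem tsum_level_left_le (h : HasSum (fun p => (c p : ℂ) • F.word p) O) {ℓ : T → ℤ}
    (hℓ : F.IsLevelFunction ℓ) (l : ℤ) (x : T) :
    ∑' z : {z // ℓ z = l}, ENNReal.ofReal (‖F.kernel O z x‖ * F.m z) ≤
      ∑' p : {p : ℕ × ℕ // (p.1 : ℤ) - p.2 = ℓ x - l}, ‖c p‖ₑ := by
  refine tsum_level_le (k := fun z => ENNReal.ofReal (‖F.kernel O z x‖ * F.m z))
    (fun z => ofReal_norm_kernel_mul_le h z x z)
    (fun p => F.tsum_enorm_kernel_word_left p x) fun p z hz hp => ?_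
  rw [kernel_word_eq_zero hℓ (by omega), enorm_zero, zero_mul]

/-! ### Multiplying word expansions by the gradient and its adjoint -/

variable (c) in
/-- The coefficients of `∇ O`, if those of `O` are `c`. -/
def diffLeft (p : ℕ × ℕ) : ℝ := c p - if p.1 = 0 then 0 else c (p.1 - 1, p.2)

variable (c) in
/-- The coefficients of `O ∇*`, if those of `O` are `c`. -/
def diffRight (p : ℕ × ℕ) : ℝ := c p - if p.2 = 0 then 0 else c (p.1, p.2 - 1)

theorem hasSum_gradient_mul (h : HasSum (fun p => (c p : ℂ) • F.word p) O) :
    HasSum (fun p => (diffLeft c p : ℂ) • F.word p) (F.gradient * O) := by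
  have h1 : HasSum (fun p : ℕ × ℕ =>
      ((if p.1 = 0 then 0 else c (p.1 - 1, p.2) : ℝ) : ℂ) • F.word p) (F.shift * O) := by
    have hinj : Function.Injective (fun p : ℕ × ℕ => (p.1 + 1, p.2)) := by
      rintro ⟨a, b⟩ ⟨a', b'⟩ hab
      simpa using hab
    rw [← hinj.hasSum_iff]
    · refine (h.mul_left F.shift).congr_fun ?_
      rintro ⟨a, b⟩
      simp [word, pow_succ', mul_assoc, -Complex.coe_smul]
    · rintro ⟨_ | a, b⟩ hab
      · simp
      · exact absurd ⟨(a, b), rfl⟩ hab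
  rw [gradient, sub_mul, one_mul]
  refine (h.sub h1).congr_fun fun p => ?_
  rw [diffLeft, ← sub_smul, Complex.ofReal_sub]

theorem hasSum_mul_gradientAdj (h : HasSum (fun p => (c p : ℂ) • F.word p) O) :
    HasSum (fun p => (diffRight c p : ℂ) • F.word p) (O * F.gradientAdj) := by
  have h1 : HasSum (fun p : ℕ × ℕ =>
      ((if p.2 = 0 then 0 else c (p.1, p.2 - 1) : ℝ) : ℂ) • F.word p) (O * F.shiftAdj) := by
    have hinj : Function.Injective (fun p : ℕ × ℕ => (p.1, p.2 + 1)) := by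
      rintro ⟨a, b⟩ ⟨a', b'⟩ hab
      simpa using hab
    rw [← hinj.hasSum_iff]
    · refine (h.mul_right F.shiftAdj).congr_fun ?_
      rintro ⟨a, b⟩
      simp [word, pow_succ, mul_assoc, -Complex.coe_smul]
    · rintro ⟨a, _ | b⟩ hab
      · simp
      · exact absurd ⟨(a, b), rfl⟩ hab
  rw [gradientAdj_eq, mul_sub, mul_one]
  refine (h.sub h1).congr_fun fun p => ?_
  rw [diffRight, ← sub_smul, Complex.ofReal_sub]

end FlowTree

end FlowTrees

end

noncomputable section

namespace FlowTrees

open PowerSeries Polynomial.Chebyshev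
open Finset.HasAntidiagonal (antidiagonal)

/-! ### The coefficients of the heat semigroup -/

/-- The generating function `∑ₙ e^{-λ} λⁿ/n! Xⁿ` of the Poisson distribution of parameter `λ`. -/
def poisson (lam : ℝ) : ℝ⟦X⟧ := PowerSeries.mk fun n => Real.exp (-lam) * (lam ^ n / n.factorial)

theorem coeff_poisson (lam : ℝ) (n : ℕ) :
    coeff n (poisson lam) = Real.exp (-lam) * (lam ^ n / n.factorial) := coeff_mk _ _

/-- The correlation sequence `k ↦ ∑ⱼ F_{j+k} f_j` of two coefficient sequences, that is, the
coefficients with index `k ≥ 0` of the Laurent series `F(z) f(1/z)`. -/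
def corr (F f : ℝ⟦X⟧) (k : ℕ) : ℝ := ∑' j, coeff (j + k) F * coeff j f

/-- The coefficient of `Σᵃ(Σ*)ᵇ`, `a + b = k`, in `e^{-tℒ}`: the difference of the probabilities
that two independent Poisson variables of parameter `t/2` differ by `k` and by `k + 2`. -/
def heatCoeff (t : ℝ) (k : ℕ) : ℝ :=
  corr (poisson (t / 2)) (poisson (t / 2)) k - corr (poisson (t / 2)) (poisson (t / 2)) (k + 2)

theorem summable_norm_poisson_mul_pow (lam r : ℝ) :
    Summable fun n => ‖coeff n (poisson lam)‖ * r ^ n := by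
  have h := (Real.summable_pow_div_factorial (‖lam‖ * r)).mul_left (Real.exp (-lam))
  refine h.congr fun n => ?_
  rw [coeff_poisson, norm_mul, Real.norm_of_nonneg (Real.exp_pos _).le, norm_div, norm_pow,
    Real.norm_natCast, mul_pow]
  ring

theorem summable_norm_poisson (lam : ℝ) : Summable fun n => ‖coeff n (poisson lam)‖ := by
  simpa using summable_norm_poisson_mul_pow lam 1

theorem summable_poisson_prod (lam : ℝ) :
    Summable fun q : ℕ × ℕ => coeff q.1 (poisson lam) * coeff q.2 (poisson lam) :=
  summable_mul_of_summable_norm (f := fun n => coeff n (poisson lam))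
    (g := fun n => coeff n (poisson lam)) (summable_norm_poisson lam) (summable_norm_poisson lam)

/-- The coefficient of the words `Σᵃ(Σ*)ᵇ`, `a + b = n`, in `U_k((Σ + Σ*)/2)`, where `U_k` is the
Chebyshev polynomial of the second kind of index `k ∈ ℤ` (so that `U_{-k-2} = -U_k`). -/
def chebCoeff (k : ℤ) (n : ℕ) : ℝ := (if k = n then 1 else 0) - if k = -n - 2 then 1 else 0

/-- Only words of length at most `i + j` occur in `U_{i-j}`. The bound has the form of a product,
which makes the four-fold sum over `i, j, a, b` absolutely convergent. -/
theorem norm_chebCoeff_le (i j a b : ℕ) :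
    ‖chebCoeff (i - j) (a + b)‖ ≤ 2 ^ i * 2 ^ j * ((1 / 2) ^ a * (1 / 2) ^ b) := by
  have h0 : (0 : ℝ) ≤ 2 ^ i * 2 ^ j * ((1 / 2) ^ a * (1 / 2) ^ b) := by positivity
  have h1 : a + b ≤ i + j → (1 : ℝ) ≤ 2 ^ i * 2 ^ j * ((1 / 2) ^ a * (1 / 2) ^ b) := by
    intro h
    rw [← pow_add, ← pow_add, one_div, inv_pow, ← div_eq_mul_inv, one_le_div (by positivity)]
    exact pow_le_pow_right₀ one_le_two h
  rw [chebCoeff]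
  split_ifs with h2 h3 h3
  · omega
  · simpa using h1 (by omega)
  · simpa using h1 (by omega)
  · simpa using h0

theorem hasSum_heatCoeff (t : ℝ) (n : ℕ) :
    HasSum (fun q : ℕ × ℕ => coeff q.1 (poisson (t / 2)) * coeff q.2 (poisson (t / 2)) *
      chebCoeff (q.1 - q.2) n) (heatCoeff t n) := by
  set f := poisson (t / 2)
  have hs := summable_poisson_prod (t / 2)
  have h1 : HasSum (fun q : ℕ × ℕ => if (q.1 : ℤ) - q.2 = n then
      coeff q.1 f * coeff q.2 f else 0) (corr f f n) := by
    have hinj : Function.Injective fun j : ℕ => (j + n, j) := fun j j' h => (Prod.ext_iff.mp h).2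
    rw [← hinj.hasSum_iff]
    · refine (hs.comp_injective hinj).hasSum.congr_fun fun j => ?_
      simp [f]
    · rintro ⟨i, j⟩ hij
      refine if_neg fun h => hij ⟨j, ?_⟩
      simp only [Prod.mk.injEq, and_true]
      simp only at h
      omega
  have h2 : HasSum (fun q : ℕ × ℕ => if (q.1 : ℤ) - q.2 = -n - 2 then
      coeff q.1 f * coeff q.2 f else 0) (corr f f (n + 2)) := by
    have hinj : Function.Injective fun i : ℕ => (i, i + (n + 2)) :=
      fun j j' h => (Prod.ext_iff.mp h).1
    have h3 : corr f f (n + 2) = ∑' i, coeff i f * coeff (i + (n + 2)) f :=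
      tsum_congr fun i => mul_comm _ _
    rw [← hinj.hasSum_iff, h3]
    · refine (hs.comp_injective hinj).hasSum.congr_fun fun j => ?_
      have h4 : (j : ℤ) - (j + (n + 2) : ℕ) = -n - 2 := by push_cast; ring
      exact if_pos h4
    · rintro ⟨i, j⟩ hij
      refine if_neg fun h => hij ⟨i, ?_⟩
      simp only [Prod.mk.injEq, true_and]
      simp only at h
      omega
  refine (h1.sub h2).congr_fun fun q => ?_
  rw [chebCoeff, mul_sub, mul_ite, mul_ite, mul_one, mul_zero]

namespace FlowTree

variable {T : Type*} [MeasurableSpace T] [DiscreteMeasurableSpace T] (F : FlowTree T)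

/-- The averaging operator `(Σ + Σ*)/2 = I - ℒ`. -/
def average : F.L2 →L[ℂ] F.L2 := (1 / 2 : ℂ) • (F.shift + F.shiftAdj)

theorem laplacian_eq : F.laplacian = 1 - F.average := by
  rw [laplacian, gradientAdj_eq, gradient, mul_sub, mul_one, sub_mul, one_mul, shiftAdj_mul_shift,
    average]
  module

theorem two_mul_average : 2 * F.average = F.shift + F.shiftAdj := by
  rw [average, two_mul]
  module

/-- The Chebyshev polynomial of the second kind `U_k((Σ + Σ*)/2)`, for any `k ∈ ℤ`. -/
def cheb (k : ℤ) : F.L2 →L[ℂ] F.L2 := Polynomial.aeval F.average (U ℂ k)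

theorem two_average_mul_cheb (k : ℤ) :
    (F.shift + F.shiftAdj) * F.cheb k = F.cheb (k + 1) + F.cheb (k - 1) := by
  rw [← two_mul_average, cheb, cheb, cheb, U_add_one, map_sub, sub_add_cancel, map_mul, map_mul,
    Polynomial.aeval_X, map_ofNat]

theorem shift_mul_word (p : ℕ × ℕ) : F.shift * F.word p = F.word (p.1 + 1, p.2) := by
  rw [word, word, ← mul_assoc, pow_succ']

theorem shiftAdj_mul_word_zero (b : ℕ) : F.shiftAdj * F.word (0, b) = F.word (0, b + 1) := by
  simp [word, pow_succ']

theorem shiftAdj_mul_word_succ (p : ℕ × ℕ) :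
    F.shiftAdj * F.word (p.1 + 1, p.2) = F.word p := by
  rw [← shift_mul_word, ← mul_assoc, shiftAdj_mul_shift, one_mul]

/-- The relation `Σ*Σ = 1` turns the Chebyshev recurrence into that of the sums of reduced words. -/
theorem cheb_natCast (n : ℕ) : F.cheb n = ∑ p ∈ antidiagonal n, F.word p := by
  induction n using Nat.twoStepInduction with
  | zero => simp [cheb, word]
  | one =>
    have h := F.two_average_mul_cheb 0
    simp only [cheb, U_zero, map_one, mul_one, zero_add, zero_sub, U_neg_one, map_zero,
      add_zero] at h
    rw [Nat.cast_one, cheb, ← h]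
    simp [word, Finset.Nat.antidiagonal_succ, add_comm]
  | more n ih1 ih2 =>
    have h := F.two_average_mul_cheb (n + 1 : ℕ)
    rw [Nat.cast_succ, add_sub_cancel_right, add_assoc, one_add_one_eq_two, ← Nat.cast_succ, ih1,
      ih2, add_mul, Finset.mul_sum, Finset.mul_sum, Finset.Nat.sum_antidiagonal_succ (n := n)
        (f := fun p => F.shiftAdj * F.word p)] at h
    simp only [shift_mul_word, shiftAdj_mul_word_zero, shiftAdj_mul_word_succ, ← add_assoc,
      add_left_inj] at h
    rw [Finset.Nat.sum_antidiagonal_succ, add_comm (F.word _)]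
    exact_mod_cast h.symm

theorem hasSum_cheb (k : ℤ) :
    HasSum (fun p : ℕ × ℕ => (chebCoeff k (p.1 + p.2) : ℂ) • F.word p) (F.cheb k) := by
  have hnat : ∀ n : ℕ, HasSum (fun p : ℕ × ℕ => (if p.1 + p.2 = n then (1 : ℂ) else 0) • F.word p)
      (F.cheb n) := by
    intro n
    rw [cheb_natCast]
    rw [Finset.sum_congr rfl (g := fun p : ℕ × ℕ =>
      (if p.1 + p.2 = n then (1 : ℂ) else 0) • F.word p)
      fun p hp => by rw [if_pos (by simpa using hp), one_smul]]
    exact hasSum_sum_of_ne_finset_zero fun p hp => by rw [if_neg (by simpa using hp), zero_smul]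
  obtain ⟨n, rfl⟩ | rfl | ⟨n, rfl⟩ : (∃ n : ℕ, k = n) ∨ k = -1 ∨ ∃ n : ℕ, k = -n - 2 := by
    rcases lt_trichotomy k (-1) with h | h | h
    · exact Or.inr (Or.inr ⟨(-k - 2).toNat, by omega⟩)
    · exact Or.inr (Or.inl h)
    · exact Or.inl ⟨k.toNat, by omega⟩
  · refine (hnat n).congr_fun fun p => ?_
    have h1 : ¬ ((n : ℤ) = -(p.1 + p.2 : ℕ) - 2) := by omega
    by_cases h2 : p.1 + p.2 = n
    · rw [chebCoeff, if_neg h1, if_pos h2, if_pos (by rw [h2])]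
      simp
    · have h3 : ¬ ((n : ℤ) = (p.1 + p.2 : ℕ)) := by omega
      rw [chebCoeff, if_neg h1, if_neg h2, if_neg h3]
      simp
  · rw [cheb, U_neg_one, map_zero]
    refine hasSum_zero.congr_fun fun p => ?_
    rw [chebCoeff, if_neg (by omega), if_neg (by omega)]
    simp
  · rw [cheb, U_neg_sub_two, map_neg]
    refine (hnat n).neg.congr_fun fun p => ?_
    have h1 : ¬ (-(n : ℤ) - 2 = (p.1 + p.2 : ℕ)) := by omega
    by_cases h2 : p.1 + p.2 = n
    · rw [chebCoeff, if_neg h1, if_pos (by omega), if_pos h2]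
      simp
    · rw [chebCoeff, if_neg h1, if_neg (by omega), if_neg h2]
      simp

theorem two_average_pow (n : ℕ) : (F.shift + F.shiftAdj) ^ n =
    ∑ q ∈ antidiagonal n, n.choose q.1 • F.cheb (q.1 - q.2) := by
  induction n with
  | zero => simp [cheb]
  | succ n ih =>
    rw [Finset.sum_antidiagonal_choose_succ_nsmul (fun i j => F.cheb (i - j)), pow_succ', ih,
      Finset.mul_sum, ← Finset.sum_add_distrib]
    refine Finset.sum_congr rfl fun q hq => ?_
    rw [Nat.choose_symm_of_eq_add (Finset.HasAntidiagonal.mem_antidiagonal.mp hq).symm,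
      mul_smul_comm, two_average_mul_cheb, ← smul_add, add_comm]
    congr 3 <;> push_cast <;> ring

theorem heat_eq (t : ℝ) : F.heat t =
    (Real.exp (-t) : ℂ) • NormedSpace.exp ((t / 2 : ℂ) • (F.shift + F.shiftAdj)) := by
  have h1 : -(t : ℂ) • F.laplacian =
      algebraMap ℂ _ (-t : ℂ) + (t / 2 : ℂ) • (F.shift + F.shiftAdj) := by
    rw [laplacian_eq, average, Algebra.algebraMap_eq_smul_one]
    module
  let +nondep : NormedAlgebra ℚ (F.L2 →L[ℂ] F.L2) := NormedAlgebra.restrictScalars ℚ ℂ _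
  rw [heat, h1, NormedSpace.exp_add_of_commute (Algebra.commutes _ _),
    ← NormedSpace.algebraMap_exp_comm, ← Complex.exp_eq_exp_ℂ, ← Algebra.smul_def, Complex.ofReal_exp,
    Complex.ofReal_neg]

theorem hasSum_heat_pow (t : ℝ) : HasSum (fun n => ∑ q ∈ antidiagonal n,
    ((coeff q.1 (poisson (t / 2)) * coeff q.2 (poisson (t / 2)) : ℝ) : ℂ) •
      F.cheb (q.1 - q.2)) (F.heat t) := by
  rw [heat_eq]
  refine ((NormedSpace.exp_series_hasSum_exp' (𝕂 := ℂ)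
    ((t / 2 : ℂ) • (F.shift + F.shiftAdj))).const_smul (Real.exp (-t) : ℂ)).congr_fun fun n => ?_
  rw [smul_pow, two_average_pow, Finset.smul_sum, Finset.smul_sum, Finset.smul_sum]
  refine Finset.sum_congr rfl fun q hq => ?_
  have hn := Finset.HasAntidiagonal.mem_antidiagonal.mp hq
  rw [← Nat.cast_smul_eq_nsmul ℂ, smul_smul, smul_smul, smul_smul]
  congr 1
  rw [coeff_poisson, coeff_poisson, ← hn, Nat.choose_symm_add, Nat.add_choose, Nat.cast_div
    (Nat.factorial_mul_factorial_dvd_factorial_add _ _) (Nat.cast_ne_zero.mpr (by positivity)),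
    show Real.exp (-t) = Real.exp (-(t / 2)) * Real.exp (-(t / 2)) by rw [← Real.exp_add]; ring_nf]
  have h1 : ((q.1 + q.2).factorial : ℂ) ≠ 0 := Nat.cast_ne_zero.mpr (Nat.factorial_ne_zero _)
  have h2 : (q.1.factorial : ℂ) ≠ 0 := Nat.cast_ne_zero.mpr (Nat.factorial_ne_zero _)
  have h3 : (q.2.factorial : ℂ) ≠ 0 := Nat.cast_ne_zero.mpr (Nat.factorial_ne_zero _)
  push_cast
  field_simp
  exact (pow_add _ _ _).symm

/-- The word expansion of the heat semigroup: the sum over `i, j` of the Chebyshev expansion and the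
sum over words are interchanged. -/
theorem hasSum_heat (t : ℝ) :
    HasSum (fun p : ℕ × ℕ => (heatCoeff t (p.1 + p.2) : ℂ) • F.word p) (F.heat t) := by
  set f := poisson (t / 2) with hf
  let G : (ℕ × ℕ) × (ℕ × ℕ) → (F.L2 →L[ℂ] F.L2) := fun r =>
    ((coeff r.1.1 f * coeff r.1.2 f * chebCoeff (r.1.1 - r.1.2) (r.2.1 + r.2.2) : ℝ) : ℂ) •
      F.word r.2
  have hG : Summable G := by
    have h1 := summable_norm_poisson_mul_pow (t / 2) 2
    have h1' : (0 : ℕ → ℝ) ≤ fun n => ‖coeff n (poisson (t / 2))‖ * 2 ^ n :=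
      fun n => by simp only [Pi.zero_apply]; positivity
    have h2 : Summable fun n : ℕ => (1 / 2 : ℝ) ^ n := summable_geometric_two
    have h2' : (0 : ℕ → ℝ) ≤ fun n => (1 / 2 : ℝ) ^ n :=
      fun n => by simp only [Pi.zero_apply]; positivity
    have h3 := (h1.mul_of_nonneg h1 h1' h1').mul_of_nonneg (h2.mul_of_nonneg h2 h2' h2')
      (fun q => mul_nonneg (h1' q.1) (h1' q.2)) (fun q => mul_nonneg (h2' q.1) (h2' q.2))
    refine Summable.of_norm_bounded h3 ?_
    rintro ⟨⟨i, j⟩, ⟨a, b⟩⟩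
    have h4 := norm_chebCoeff_le i j a b
    calc ‖G ((i, j), (a, b))‖ ≤ ‖coeff i f‖ * ‖coeff j f‖ * ‖chebCoeff (i - j) (a + b)‖ * 1 := by
          simp only [G]
          rw [norm_smul, Complex.norm_real, norm_mul, norm_mul]
          gcongr
          exact F.norm_word_le _
      _ ≤ ‖coeff i f‖ * ‖coeff j f‖ * (2 ^ i * 2 ^ j * ((1 / 2) ^ a * (1 / 2) ^ b)) * 1 := by
          gcongr
      _ = _ := by
          simp only [hf]
          ring
  have hsum := hG.hasSum
  have h1 : HasSum (fun q : ℕ × ℕ => ((coeff q.1 f * coeff q.2 f : ℝ) : ℂ) •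
      F.cheb (q.1 - q.2)) (∑' r, G r) := by
    refine hsum.prod_fiberwise fun q => ?_
    refine ((F.hasSum_cheb (q.1 - q.2)).const_smul
      ((coeff q.1 f * coeff q.2 f : ℝ) : ℂ)).congr_fun fun p => ?_
    rw [smul_smul, ← Complex.ofReal_mul]
  have h2 : HasSum (fun n => ∑ q ∈ antidiagonal n, ((coeff q.1 f * coeff q.2 f : ℝ) : ℂ) •
      F.cheb (q.1 - q.2)) (∑' r, G r) := by
    rw [← Finset.HasAntidiagonal.sigmaAntidiagonalEquivProd.hasSum_iff] at h1
    refine h1.sigma fun n => ?_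
    exact Finset.hasSum (antidiagonal n)
      (fun q : ℕ × ℕ => ((coeff q.1 f * coeff q.2 f : ℝ) : ℂ) • F.cheb (q.1 - q.2))
  rw [(F.hasSum_heat_pow t).unique h2]
  refine ((Equiv.prodComm _ _).hasSum_iff.mpr hsum).prod_fiberwise fun p => ?_
  exact ((Complex.hasSum_ofReal.mpr (hasSum_heatCoeff t (p.1 + p.2))).smul_const (F.word p))

end FlowTree

end FlowTrees

end

noncomputable section

namespace FlowTrees

open PowerSeries
open Finset.HasAntidiagonal (antidiagonal)

/-! ### Weighted norms of power series -/

/-- The weighted `ℓ¹` norm `∑ₙ |Fₙ| zⁿ` of a power series, as an element of `[0,∞]`. -/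
def wnorm (z : ℝ≥0∞) (F : ℝ⟦X⟧) : ℝ≥0∞ := ∑' n, ‖coeff n F‖ₑ * z ^ n

theorem tsum_antidiagonal (φ : ℕ × ℕ → ℝ≥0∞) :
    ∑' n, ∑ q ∈ antidiagonal n, φ q = ∑' q, φ q := by
  rw [← Finset.HasAntidiagonal.sigmaAntidiagonalEquivProd.tsum_eq, ENNReal.tsum_sigma']
  exact tsum_congr fun n => (Finset.tsum_subtype (antidiagonal n) φ).symm

theorem wnorm_mul_le (z : ℝ≥0∞) (F G : ℝ⟦X⟧) : wnorm z (F * G) ≤ wnorm z F * wnorm z G := by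
  calc wnorm z (F * G)
      ≤ ∑' n, ∑ q ∈ antidiagonal n, ‖coeff q.1 F‖ₑ * z ^ q.1 * (‖coeff q.2 G‖ₑ * z ^ q.2) := by
        refine ENNReal.tsum_le_tsum fun n => ?_
        rw [coeff_mul]
        refine (mul_le_mul_left (enorm_sum_le _ _) _).trans_eq ?_
        rw [Finset.sum_mul]
        refine Finset.sum_congr rfl fun q hq => ?_
        rw [enorm_mul, ← Finset.HasAntidiagonal.mem_antidiagonal.mp hq, pow_add]
        ring
    _ = wnorm z F * wnorm z G := by
        rw [tsum_antidiagonal fun q => ‖coeff q.1 F‖ₑ * z ^ q.1 * (‖coeff q.2 G‖ₑ * z ^ q.2),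
          ENNReal.tsum_prod (f := fun i j => ‖coeff i F‖ₑ * z ^ i * (‖coeff j G‖ₑ * z ^ j)),
          wnorm, wnorm, ← ENNReal.tsum_mul_right]
        simp_rw [ENNReal.tsum_mul_left]

theorem wnorm_one (z : ℝ≥0∞) : wnorm z 1 = 1 := by
  rw [wnorm, tsum_eq_single 0]
  · simp
  · intro n hn
    simp [coeff_one, hn]

theorem wnorm_pow_le (z : ℝ≥0∞) (F : ℝ⟦X⟧) (n : ℕ) : wnorm z (F ^ n) ≤ wnorm z F ^ n := by
  induction n with
  | zero => rw [pow_zero, pow_zero, wnorm_one]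
  | succ n ih =>
    rw [pow_succ, pow_succ]
    exact (wnorm_mul_le z _ _).trans (mul_le_mul_left ih _)

theorem wnorm_one_sub_X : wnorm 1 (1 - X) = 2 := by
  rw [wnorm, tsum_eq_zero_add' ENNReal.summable, tsum_eq_single 0]
  · simp [coeff_one, coeff_X, one_add_one_eq_two]
  · intro n hn
    simp [coeff_one, coeff_X, hn]

theorem summable_norm_coeff_one_sub_X_mul {F : ℝ⟦X⟧} (hF : Summable fun n => ‖coeff n F‖) :
    Summable fun n => ‖coeff n ((1 - X) * F)‖ := by
  rw [← summable_nat_add_iff 1]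
  refine Summable.of_nonneg_of_le (fun _ => norm_nonneg _) (fun n => ?_)
    (((summable_nat_add_iff 1).mpr hF).add hF)
  rw [sub_mul, one_mul, map_sub, coeff_succ_X_mul]
  exact norm_sub_le _ _

theorem summable_norm_coeff_one_sub_X_pow_mul {F : ℝ⟦X⟧} (hF : Summable fun n => ‖coeff n F‖)
    (j : ℕ) : Summable fun n => ‖coeff n ((1 - X) ^ j * F)‖ := by
  induction j with
  | zero => simpa using hF
  | succ j ih =>
    rw [pow_succ', mul_assoc]
    exact summable_norm_coeff_one_sub_X_mul ih

theorem summable_corr {F f : ℝ⟦X⟧} (hF : Summable fun n => ‖coeff n F‖)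
    (hf : Summable fun n => ‖coeff n f‖) (k : ℕ) :
    Summable fun j => coeff (j + k) F * coeff j f :=
  (summable_mul_of_summable_norm (f := fun n => coeff n F) (g := fun n => coeff n f)
    hF hf).comp_injective (i := fun j : ℕ => (j + k, j)) fun _ _ h => (Prod.ext_iff.mp h).2

/-- Multiplication of the first factor by `1 - X` takes differences of the correlations. -/
theorem corr_one_sub_X_mul {F f : ℝ⟦X⟧} (hF : Summable fun n => ‖coeff n F‖)
    (hf : Summable fun n => ‖coeff n f‖) (k : ℕ) :
    corr ((1 - X) * F) f (k + 1) = corr F f (k + 1) - corr F f k := by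
  rw [corr, corr, corr, ← (summable_corr hF hf (k + 1)).tsum_sub (summable_corr hF hf k)]
  refine tsum_congr fun j => ?_
  rw [sub_mul, one_mul, map_sub, ← add_assoc, coeff_succ_X_mul, sub_mul]

theorem tsum_enorm_corr_le {z : ℝ≥0∞} (h0 : z ≠ 0) (htop : z ≠ ∞) (F f : ℝ⟦X⟧) :
    ∑' k, ‖corr F f k‖ₑ * z ^ k ≤ wnorm z F * wnorm z⁻¹ f := by
  calc ∑' k, ‖corr F f k‖ₑ * z ^ k
      ≤ ∑' k, ∑' j, ‖coeff (j + k) F‖ₑ * z ^ (j + k) * (‖coeff j f‖ₑ * z⁻¹ ^ j) := by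
        refine ENNReal.tsum_le_tsum fun k => ?_
        refine (mul_le_mul_left enorm_tsum_le_tsum_enorm _).trans_eq ?_
        rw [← ENNReal.tsum_mul_right]
        refine tsum_congr fun j => ?_
        have hz : z ^ j * z⁻¹ ^ j = 1 := by
          rw [← mul_pow, ENNReal.mul_inv_cancel h0 htop, one_pow]
        rw [enorm_mul, pow_add]
        calc _ = ‖coeff (j + k) F‖ₑ * ‖coeff j f‖ₑ * z ^ k * (z ^ j * z⁻¹ ^ j) := by
              rw [hz, mul_one]
          _ = _ := by ring
    _ = ∑' j, (∑' k, ‖coeff (j + k) F‖ₑ * z ^ (j + k)) * (‖coeff j f‖ₑ * z⁻¹ ^ j) := by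
        rw [ENNReal.tsum_comm]
        simp_rw [ENNReal.tsum_mul_right]
    _ ≤ ∑' j, wnorm z F * (‖coeff j f‖ₑ * z⁻¹ ^ j) := by
        refine ENNReal.tsum_le_tsum fun j => mul_le_mul_left ?_ _
        exact ENNReal.tsum_comp_le_tsum_of_injective (add_right_injective j)
          fun n => ‖coeff n F‖ₑ * z ^ n
    _ = wnorm z F * wnorm z⁻¹ f := ENNReal.tsum_mul_left

/-! ### Differences of Poisson weights -/

theorem poisson_eq (lam : ℝ) :
    poisson lam = C (Real.exp (-lam)) * rescale lam (PowerSeries.exp ℝ) := by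
  ext n
  rw [coeff_poisson, coeff_C_mul, coeff_rescale, coeff_exp, div_eq_mul_inv]
  simp

theorem poisson_mul_poisson (a b : ℝ) : poisson a * poisson b = poisson (a + b) := by
  rw [poisson_eq, poisson_eq, poisson_eq, mul_mul_mul_comm, exp_mul_exp_eq_exp_add, ← map_mul,
    ← Real.exp_add, neg_add]

theorem poisson_pow_succ (a : ℝ) (n : ℕ) : poisson a ^ (n + 1) = poisson ((n + 1) * a) := by
  induction n with
  | zero => simp
  | succ n ih =>
    rw [pow_succ, ih, poisson_mul_poisson]
    push_cast
    ring_nf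

theorem hasSum_exp (x : ℝ) : HasSum (fun n : ℕ => x ^ n / n.factorial) (Real.exp x) := by
  rw [Real.exp_eq_exp_ℝ]
  exact NormedSpace.expSeries_div_hasSum_exp x

theorem hasSum_nat_mul_exp (x : ℝ) :
    HasSum (fun n : ℕ => n * (x ^ n / n.factorial)) (x * Real.exp x) := by
  rw [← hasSum_nat_add_iff' 1]
  simp only [Finset.range_one, Finset.sum_singleton, Nat.cast_zero, zero_mul, sub_zero]
  refine ((hasSum_exp x).mul_left x).congr_fun fun n => ?_
  rw [Nat.factorial_succ]
  push_cast
  have : (n : ℝ) + 1 ≠ 0 := by positivity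
  field_simp
  ring

theorem hasSum_nat_sq_mul_exp (x : ℝ) :
    HasSum (fun n : ℕ => (n : ℝ) ^ 2 * (x ^ n / n.factorial)) ((x ^ 2 + x) * Real.exp x) := by
  rw [← hasSum_nat_add_iff' 1]
  simp only [Finset.range_one, Finset.sum_singleton, Nat.cast_zero, zero_mul, sub_zero,
    ne_eq, OfNat.ofNat_ne_zero, not_false_eq_true, zero_pow]
  have h := ((hasSum_nat_mul_exp x).add (hasSum_exp x)).mul_left x
  rw [show x * (x * Real.exp x + Real.exp x) = (x ^ 2 + x) * Real.exp x by ring] at h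
  refine h.congr_fun fun n => ?_
  rw [Nat.factorial_succ]
  push_cast
  have : (n : ℝ) + 1 ≠ 0 := by positivity
  field_simp
  ring

theorem wnorm_poisson {lam z : ℝ} (hl : 0 ≤ lam) (hz : 0 ≤ z) :
    wnorm (ENNReal.ofReal z) (poisson lam) = ENNReal.ofReal (Real.exp (lam * (z - 1))) := by
  have h : HasSum (fun n : ℕ => Real.exp (-lam) * ((lam * z) ^ n / n.factorial))
      (Real.exp (lam * (z - 1))) := by
    have := (hasSum_exp (lam * z)).mul_left (Real.exp (-lam))
    rwa [← Real.exp_add, show -lam + lam * z = lam * (z - 1) by ring] at this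
  rw [← h.tsum_eq, ENNReal.ofReal_tsum_of_nonneg (fun n => by positivity) h.summable, wnorm]
  refine tsum_congr fun n => ?_
  rw [← ENNReal.ofReal_pow hz, ← ofReal_norm, ← ENNReal.ofReal_mul (norm_nonneg _), coeff_poisson,
    Real.norm_of_nonneg (by positivity), mul_pow]
  congr 1
  ring

theorem coeff_one_sub_X_mul_poisson {lam : ℝ} (hl : lam ≠ 0) (n : ℕ) :
    coeff n ((1 - X) * poisson lam) =
      Real.exp (-lam) * (lam ^ n / n.factorial) * (1 - n / lam) := by
  rcases n with _ | n
  · rw [sub_mul, one_mul, map_sub, coeff_zero_X_mul, coeff_poisson]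
    simp
  · rw [sub_mul, one_mul, map_sub, coeff_succ_X_mul, coeff_poisson, coeff_poisson,
      Nat.factorial_succ]
    push_cast
    have : (n : ℝ) + 1 ≠ 0 := by positivity
    field_simp
    ring

/-- The differences of the Poisson weights of parameter `λ` gain a factor `λ^{-1/2}`, also in
exponentially weighted norms with `z - 1` of order `λ^{-1/2}`. -/
theorem wnorm_one_sub_X_mul_poisson_le {lam z : ℝ} (hl : 0 < lam) (hz : 0 ≤ z) :
    wnorm (ENNReal.ofReal z) ((1 - X) * poisson lam) ≤ ENNReal.ofReal
      (Real.exp (lam * (z - 1)) * ((lam * (z - 1) ^ 2 + z + 1) / (2 * √lam))) := by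
  set s := √lam with hs
  have hs0 : 0 < s := Real.sqrt_pos.mpr hl
  have hs2 : lam = s ^ 2 := (Real.sq_sqrt hl.le).symm
  -- the weights `λⁿ/n! |1 - n/λ|` are estimated by means of `2|u| ≤ s u² + 1/s`, which leads to
  -- the second moment of the Poisson distribution of parameter `λ z`
  have h : HasSum (fun n : ℕ => Real.exp (-lam) / 2 * (s * ((lam * z) ^ n / n.factorial -
        2 / lam * (n * ((lam * z) ^ n / n.factorial)) +
        1 / lam ^ 2 * ((n : ℝ) ^ 2 * ((lam * z) ^ n / n.factorial))) +
        1 / s * ((lam * z) ^ n / n.factorial)))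
      (Real.exp (lam * (z - 1)) * ((lam * (z - 1) ^ 2 + z + 1) / (2 * s))) := by
    have h1 := (((((hasSum_exp (lam * z)).sub
      ((hasSum_nat_mul_exp (lam * z)).mul_left (2 / lam))).add
      ((hasSum_nat_sq_mul_exp (lam * z)).mul_left (1 / lam ^ 2))).mul_left s).add
      ((hasSum_exp (lam * z)).mul_left (1 / s))).mul_left (Real.exp (-lam) / 2)
    have h2 : Real.exp (lam * (z - 1)) * ((lam * (z - 1) ^ 2 + z + 1) / (2 * s)) =
        Real.exp (-lam) / 2 * (s * (Real.exp (lam * z) -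
          2 / lam * (lam * z * Real.exp (lam * z)) +
          1 / lam ^ 2 * (((lam * z) ^ 2 + lam * z) * Real.exp (lam * z))) +
          1 / s * Real.exp (lam * z)) := by
      rw [show lam * (z - 1) = -lam + lam * z by ring, Real.exp_add]
      generalize Real.exp (-lam) = E₁
      generalize Real.exp (lam * z) = E₂
      rw [hs2]
      field_simp
      ring
    rw [h2]
    exact h1
  have hle : ∀ n : ℕ, ‖coeff n ((1 - X) * poisson lam)‖ * z ^ n ≤ Real.exp (-lam) / 2 *
      (s * ((lam * z) ^ n / n.factorial - 2 / lam * (n * ((lam * z) ^ n / n.factorial)) +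
        1 / lam ^ 2 * ((n : ℝ) ^ 2 * ((lam * z) ^ n / n.factorial))) +
        1 / s * ((lam * z) ^ n / n.factorial)) := by
    intro n
    have habs : |1 - n / lam| ≤ (s * (1 - n / lam) ^ 2 + 1 / s) / 2 := by
      rw [← sq_abs (1 - n / lam)]
      set u := |1 - n / lam|
      have h2 : 0 ≤ (s * u - 1) ^ 2 / s := by positivity
      have h3 : (s * u - 1) ^ 2 / s = s * u ^ 2 + 1 / s - 2 * u := by
        field_simp
        ring
      linarith
    rw [coeff_one_sub_X_mul_poisson hl.ne', norm_mul, Real.norm_of_nonneg (by positivity),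
      Real.norm_eq_abs]
    calc _ ≤ Real.exp (-lam) * (lam ^ n / n.factorial) * ((s * (1 - n / lam) ^ 2 + 1 / s) / 2) *
          z ^ n := by gcongr
      _ = _ := by
          rw [mul_pow]
          field_simp
          ring
  rw [← h.tsum_eq, ENNReal.ofReal_tsum_of_nonneg
    (fun n => (mul_nonneg (norm_nonneg _) (pow_nonneg hz n)).trans (hle n)) h.summable, wnorm]
  refine ENNReal.tsum_le_tsum fun n => ?_
  rw [← ENNReal.ofReal_pow hz, ← ofReal_norm, ← ENNReal.ofReal_mul (norm_nonneg _)]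
  exact ENNReal.ofReal_le_ofReal (hle n)

/-- The `j`-th differences of the distribution of the difference of two independent Poisson
variables of parameter `t/2`. -/
def corrDiff (t : ℝ) (j k : ℕ) : ℝ := corr ((1 - X) ^ j * poisson (t / 2)) (poisson (t / 2)) k

/-- The constant in the estimate of the `j`-th differences. -/
def diffConst (α : ℝ) (j : ℕ) : ℝ :=
  Real.exp (α ^ 2 * Real.exp α ^ 2) * (j * (α ^ 2 * Real.exp α ^ 2 + Real.exp α + 1)) ^ j

/-- Each difference gains a factor `t^{-1/2}`: the Poisson weights of parameter `λ = t/2` are the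
`j`-fold convolution of those of parameter `λ/j`, and each factor absorbs one difference. -/
theorem tsum_enorm_corrDiff_le {α t : ℝ} (hα : 0 ≤ α) (ht : 1 ≤ t) (j : ℕ) :
    ∑' k, ‖corrDiff t (j + 1) k‖ₑ * ENNReal.ofReal (Real.exp (α / √t)) ^ k ≤
      ENNReal.ofReal (diffConst α (j + 1) / √t ^ (j + 1)) := by
  set z := Real.exp (α / √t) with hz
  set B := α ^ 2 * Real.exp α ^ 2 with hB
  set lam := t / 2 with hlam
  have hl : 0 < lam := by positivity
  have hz0 : 0 < z := Real.exp_pos _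
  have hst : 1 ≤ √t := Real.one_le_sqrt.mpr ht
  have hst0 : 0 < √t := by positivity
  have hst2 : √t ^ 2 = t := Real.sq_sqrt (by positivity)
  have hzα : z ≤ Real.exp α := Real.exp_le_exp.mpr (div_le_self hα hst)
  have hz1 : 1 ≤ z := Real.one_le_exp (by positivity)
  have hB0 : 0 ≤ B := by positivity
  have hzB : lam * (z - 1) ^ 2 ≤ B := by
    have h1 : z - 1 ≤ α / √t * Real.exp α := by
      have h2 := Real.add_one_le_exp (-(α / √t))
      rw [Real.exp_neg, ← hz] at h2
      have h3 : z * (-(α / √t) + 1) ≤ 1 := by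
        calc _ ≤ z * z⁻¹ := by gcongr
          _ = 1 := mul_inv_cancel₀ hz0.ne'
      have h4 : α / √t * z ≤ α / √t * Real.exp α := by gcongr
      linarith
    have h5 : (z - 1) ^ 2 ≤ (α / √t * Real.exp α) ^ 2 :=
      pow_le_pow_left₀ (by linarith) h1 2
    have h6 : lam * (α / √t * Real.exp α) ^ 2 = B / 2 := by
      rw [mul_pow, div_pow, hst2, hlam, hB]
      field_simp
    calc lam * (z - 1) ^ 2 ≤ lam * (α / √t * Real.exp α) ^ 2 := by gcongr
      _ ≤ B := by linarith
  set n : ℝ := (j : ℝ) + 1 with hn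
  have hn1 : 1 ≤ n := by simp [hn]
  have hn0 : 0 < n := by positivity
  have hpow : (1 - X) ^ (j + 1) * poisson lam = ((1 - X) * poisson (lam / n)) ^ (j + 1) := by
    rw [mul_pow, poisson_pow_succ, ← hn, mul_div_cancel₀ _ hn0.ne']
  have hfac : (lam / n * (z - 1) ^ 2 + z + 1) / (2 * √(lam / n)) ≤
      n * (B + Real.exp α + 1) / √t := by
    have h1 : lam / n * (z - 1) ^ 2 ≤ B := by
      calc lam / n * (z - 1) ^ 2 ≤ lam * (z - 1) ^ 2 := by
            gcongr
            exact div_le_self hl.le hn1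
        _ ≤ B := hzB
    have h2 : √t / n ≤ 2 * √(lam / n) := by
      refine le_of_sq_le_sq ?_ (by positivity)
      rw [div_pow, hst2, mul_pow, Real.sq_sqrt (by positivity), hlam,
        div_le_iff₀ (by positivity)]
      have : 2 ^ 2 * (t / 2 / n) * n ^ 2 = 2 * t * n := by
        field_simp
      rw [this]
      nlinarith
    calc _ ≤ (B + Real.exp α + 1) / (√t / n) := by gcongr
      _ = _ := by
        field_simp
  have hexp : Real.exp (lam / n * (z - 1)) ^ (j + 1) * Real.exp (lam * (z⁻¹ - 1)) ≤
      Real.exp B := by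
    rw [← Real.exp_nat_mul, ← Real.exp_add]
    refine Real.exp_le_exp.mpr ?_
    have h1 : ((j + 1 : ℕ) : ℝ) * (lam / n * (z - 1)) + lam * (z⁻¹ - 1) =
        lam * (z - 1) ^ 2 / z := by
      push_cast
      rw [← hn]
      field_simp
      ring
    rw [h1]
    exact (div_le_self (by positivity) hz1).trans hzB
  calc _ ≤ wnorm (ENNReal.ofReal z) (((1 - X) * poisson (lam / n)) ^ (j + 1)) *
        wnorm (ENNReal.ofReal z⁻¹) (poisson lam) := by
        rw [← hpow, ENNReal.ofReal_inv_of_pos hz0]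
        exact tsum_enorm_corr_le (by simpa using hz0) ENNReal.ofReal_ne_top _ _
    _ ≤ ENNReal.ofReal (Real.exp (lam / n * (z - 1)) *
          ((lam / n * (z - 1) ^ 2 + z + 1) / (2 * √(lam / n)))) ^ (j + 1) *
          ENNReal.ofReal (Real.exp (lam * (z⁻¹ - 1))) := by
        rw [wnorm_poisson hl.le (inv_nonneg.mpr hz0.le)]
        gcongr
        refine (wnorm_pow_le _ _ _).trans ?_
        gcongr
        exact wnorm_one_sub_X_mul_poisson_le (by positivity) hz0.le
    _ ≤ _ := by
        rw [← ENNReal.ofReal_pow (by positivity), ← ENNReal.ofReal_mul (by positivity)]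
        refine ENNReal.ofReal_le_ofReal ?_
        rw [mul_pow, mul_right_comm, diffConst, mul_div_assoc, ← div_pow, ← hB]
        push_cast
        rw [← hn]
        gcongr

/-- A bound for the second differences that is uniform in `t`. -/
theorem tsum_enorm_corrDiff_two_le {t : ℝ} (ht : 0 ≤ t) :
    ∑' k, ‖corrDiff t 2 k‖ₑ ≤ 4 := by
  have h := tsum_enorm_corr_le one_ne_zero ENNReal.one_ne_top ((1 - X) ^ 2 * poisson (t / 2))
    (poisson (t / 2))
  have h1 : wnorm 1 (poisson (t / 2)) = 1 := by
    have := wnorm_poisson (lam := t / 2) (by positivity) zero_le_one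
    simpa using this
  have h2 : wnorm 1 ((1 - X) ^ 2 * poisson (t / 2)) ≤ 4 := by
    refine (wnorm_mul_le _ _ _).trans ?_
    rw [h1, mul_one]
    refine (wnorm_pow_le _ _ _).trans ?_
    rw [wnorm_one_sub_X]
    norm_num
  simp only [one_pow, mul_one, inv_one, h1] at h
  exact h.trans h2

end FlowTrees

end

noncomputable section

namespace FlowTrees

open FlowTree

/-! ### Estimates for the coefficients of the heat semigroup and their differences -/

/-- The first differences of the coefficients of the heat semigroup, with the convention that the
coefficient of index `-1` vanishes. -/
def heatDiff (t : ℝ) (k : ℕ) : ℝ := heatCoeff t k - if k = 0 then 0 else heatCoeff t (k - 1)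

/-- The second differences of the coefficients of the heat semigroup; the value at `0` is `0`, as
`0 - 1 = 0` in `ℕ`. -/
def heatDiff₂ (t : ℝ) (k : ℕ) : ℝ := heatDiff t k - heatDiff t (k - 1)

theorem corrDiff_succ_succ (t : ℝ) (j k : ℕ) :
    corrDiff t (j + 1) (k + 1) = corrDiff t j (k + 1) - corrDiff t j k := by
  rw [corrDiff, pow_succ', mul_assoc, corr_one_sub_X_mul
    (summable_norm_coeff_one_sub_X_pow_mul (summable_norm_poisson _) j)
    (summable_norm_poisson _)]
  rfl

/-- The difference distribution is symmetric, so its increments from `-1` to `0` and from `0` to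
`1` are opposite. -/
theorem corrDiff_one_zero (t : ℝ) : corrDiff t 1 0 = -corrDiff t 1 1 := by
  set f := poisson (t / 2) with hf
  have hs : Summable fun n => ‖PowerSeries.coeff n f‖ := summable_norm_poisson _
  have h0 := summable_corr hs hs 0
  have h1 := summable_corr hs hs 1
  have hX : Summable fun j => PowerSeries.coeff j (PowerSeries.X * f) * PowerSeries.coeff j f := by
    rw [← summable_nat_add_iff 1]
    refine h1.congr fun j => ?_
    rw [PowerSeries.coeff_succ_X_mul, mul_comm]
  have hX1 : ∑' j, PowerSeries.coeff j (PowerSeries.X * f) * PowerSeries.coeff j f =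
      corr f f 1 := by
    rw [hX.tsum_eq_zero_add, PowerSeries.coeff_zero_X_mul, zero_mul, zero_add]
    refine tsum_congr fun j => ?_
    rw [PowerSeries.coeff_succ_X_mul, mul_comm]
  have h2 : corrDiff t 1 0 = corr f f 0 - corr f f 1 := by
    rw [← hX1, corrDiff, corr, corr, ← h0.tsum_sub hX]
    refine tsum_congr fun j => ?_
    rw [pow_one, sub_mul, one_mul, map_sub, add_zero, sub_mul]
  rw [h2, corrDiff_succ_succ, corrDiff, corrDiff, pow_zero, one_mul]
  ring

theorem heatCoeff_eq (t : ℝ) (k : ℕ) :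
    heatCoeff t k = -(corrDiff t 1 (k + 2) + corrDiff t 1 (k + 1)) := by
  rw [corrDiff_succ_succ, corrDiff_succ_succ, corrDiff, corrDiff, corrDiff, pow_zero, one_mul,
    heatCoeff]
  ring

theorem heatDiff_eq (t : ℝ) (k : ℕ) :
    heatDiff t k = -(corrDiff t 2 (k + 2) + corrDiff t 2 (k + 1)) := by
  rw [heatDiff, corrDiff_succ_succ t 1 (k + 1), corrDiff_succ_succ t 1 k, heatCoeff_eq]
  rcases k with _ | k
  · rw [if_pos rfl, corrDiff_one_zero]
    ring
  · rw [if_neg k.succ_ne_zero, Nat.add_sub_cancel, heatCoeff_eq]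
    ring

theorem heatDiff₂_succ (t : ℝ) (k : ℕ) :
    heatDiff₂ t (k + 1) = -(corrDiff t 3 (k + 3) + corrDiff t 3 (k + 2)) := by
  rw [heatDiff₂, corrDiff_succ_succ t 2 (k + 2), corrDiff_succ_succ t 2 (k + 1), heatDiff_eq,
    Nat.add_sub_cancel, heatDiff_eq]
  ring

theorem heatCoeff_eq_sum (t : ℝ) (k : ℕ) :
    heatCoeff t k = ∑ i ∈ Finset.range (k + 1), heatDiff t i := by
  induction k with
  | zero => simp [heatDiff]
  | succ k ih =>
    rw [Finset.sum_range_succ, ← ih, heatDiff, if_neg k.succ_ne_zero, Nat.add_sub_cancel]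
    ring

theorem enorm_heatCoeff_le (t : ℝ) (k : ℕ) : ‖heatCoeff t k‖ₑ ≤ ∑' i, ‖heatDiff t i‖ₑ := by
  rw [heatCoeff_eq_sum]
  exact (enorm_sum_le _ _).trans (ENNReal.sum_le_tsum _)

theorem tsum_enorm_le_two_mul {z : ℝ≥0∞} (hz : 1 ≤ z) {φ ψ : ℕ → ℝ}
    (h : ∀ k, ‖φ k‖ₑ ≤ ‖ψ (k + 2)‖ₑ + ‖ψ (k + 1)‖ₑ) :
    ∑' k, ‖φ k‖ₑ * z ^ k ≤ 2 * ∑' k, ‖ψ k‖ₑ * z ^ k := by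
  have hshift : ∀ i, ∑' k, ‖ψ (k + i)‖ₑ * z ^ k ≤ ∑' k, ‖ψ k‖ₑ * z ^ k := by
    intro i
    refine le_trans (ENNReal.tsum_le_tsum fun k => ?_)
      (ENNReal.tsum_comp_le_tsum_of_injective (add_left_injective i) fun k => ‖ψ k‖ₑ * z ^ k)
    exact mul_le_mul_right (pow_le_pow_right₀ hz (Nat.le_add_right k i)) _
  calc _ ≤ ∑' k, (‖ψ (k + 2)‖ₑ * z ^ k + ‖ψ (k + 1)‖ₑ * z ^ k) := by
        refine ENNReal.tsum_le_tsum fun k => ?_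
        rw [← add_mul]
        exact mul_le_mul_left (h k) _
    _ ≤ _ := by
        rw [ENNReal.tsum_add, two_mul]
        exact add_le_add (hshift 2) (hshift 1)

theorem enorm_neg_add_le (a b : ℝ) : ‖-(a + b)‖ₑ ≤ ‖a‖ₑ + ‖b‖ₑ := by
  rw [enorm_neg]
  exact enorm_add_le a b

theorem enorm_heatDiff_le (t : ℝ) (k : ℕ) :
    ‖heatDiff t k‖ₑ ≤ ‖corrDiff t 2 (k + 2)‖ₑ + ‖corrDiff t 2 (k + 1)‖ₑ := by
  rw [heatDiff_eq]
  exact enorm_neg_add_le _ _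

theorem two_mul_tsum_enorm_corrDiff_le {α t : ℝ} (hα : 0 ≤ α) (ht : 1 ≤ t) (j : ℕ) :
    2 * ∑' k, ‖corrDiff t (j + 1) k‖ₑ * ENNReal.ofReal (Real.exp (α / √t)) ^ k ≤
      ENNReal.ofReal (2 * diffConst α (j + 1) / √t ^ (j + 1)) := by
  rw [mul_div_assoc, ENNReal.ofReal_mul zero_le_two, ENNReal.ofReal_ofNat]
  gcongr
  exact tsum_enorm_corrDiff_le hα ht j

theorem one_le_ofReal_exp {α t : ℝ} (hα : 0 ≤ α) : 1 ≤ ENNReal.ofReal (Real.exp (α / √t)) :=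
  ENNReal.one_le_ofReal.mpr (Real.one_le_exp (by positivity))

theorem tsum_enorm_heatCoeff_le {α t : ℝ} (hα : 0 ≤ α) (ht : 1 ≤ t) :
    ∑' k, ‖heatCoeff t k‖ₑ * ENNReal.ofReal (Real.exp (α / √t)) ^ k ≤
      ENNReal.ofReal (2 * diffConst α 1 / √t) := by
  refine (tsum_enorm_le_two_mul (one_le_ofReal_exp hα) (ψ := corrDiff t 1) fun k => ?_).trans ?_
  · rw [heatCoeff_eq]
    exact enorm_neg_add_le _ _
  · simpa using two_mul_tsum_enorm_corrDiff_le hα ht 0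

theorem tsum_enorm_heatDiff_le {α t : ℝ} (hα : 0 ≤ α) (ht : 1 ≤ t) :
    ∑' k, ‖heatDiff t k‖ₑ * ENNReal.ofReal (Real.exp (α / √t)) ^ k ≤
      ENNReal.ofReal (2 * diffConst α 2 / t) := by
  refine (tsum_enorm_le_two_mul (one_le_ofReal_exp hα) (ψ := corrDiff t 2)
    (enorm_heatDiff_le t)).trans ?_
  have h := two_mul_tsum_enorm_corrDiff_le hα ht 1
  rwa [Real.sq_sqrt (by positivity)] at h

theorem tsum_enorm_heatDiff₂_le {α t : ℝ} (hα : 0 ≤ α) (ht : 1 ≤ t) :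
    ∑' k, ‖heatDiff₂ t k‖ₑ * ENNReal.ofReal (Real.exp (α / √t)) ^ k ≤
      ENNReal.ofReal (2 * diffConst α 3 / √t ^ 3) := by
  refine (tsum_enorm_le_two_mul (one_le_ofReal_exp hα)
    (ψ := fun k => corrDiff t 3 k) fun k => ?_).trans (two_mul_tsum_enorm_corrDiff_le hα ht 2)
  rcases k with _ | k
  · simp [heatDiff₂]
  · rw [heatDiff₂_succ]
    exact enorm_neg_add_le _ _

theorem tsum_enorm_heatDiff_le_div {t : ℝ} (ht : 0 < t) :
    ∑' k, ‖heatDiff t k‖ₑ ≤ ENNReal.ofReal (64 / (1 + t)) := by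
  rcases le_or_gt 1 t with h1 | h1
  · have h := tsum_enorm_heatDiff_le le_rfl h1
    simp only [zero_div, Real.exp_zero, ENNReal.ofReal_one, one_pow, mul_one] at h
    refine h.trans (ENNReal.ofReal_le_ofReal ?_)
    have h2 : diffConst 0 2 = 16 := by
      norm_num [diffConst]
    rw [h2, div_le_div_iff₀ ht (by positivity)]
    linarith
  · have h := tsum_enorm_le_two_mul (le_refl (1 : ℝ≥0∞)) (enorm_heatDiff_le t)
    simp only [one_pow, mul_one] at h
    calc _ ≤ 2 * ∑' k, ‖corrDiff t 2 k‖ₑ := h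
      _ ≤ 2 * 4 := by
          gcongr
          exact tsum_enorm_corrDiff_two_le ht.le
      _ = ENNReal.ofReal 8 := by norm_num
      _ ≤ _ := by
          refine ENNReal.ofReal_le_ofReal ?_
          rw [le_div_iff₀ (by positivity)]
          linarith

theorem two_mul_tsum_enorm_heatDiff_le {t : ℝ} (ht : 0 < t) :
    2 * ∑' k, ‖heatDiff t k‖ₑ ≤ ENNReal.ofReal (128 / (1 + t)) := by
  rw [show (128 : ℝ) / (1 + t) = 2 * (64 / (1 + t)) by ring, ENNReal.ofReal_mul zero_le_two,
    ENNReal.ofReal_ofNat]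
  gcongr
  exact tsum_enorm_heatDiff_le_div ht

/-! ### Sums over words -/

theorem tsum_add_eq (φ : ℕ → ℝ≥0∞) :
    ∑' p : ℕ × ℕ, φ (p.1 + p.2) = ∑' n : ℕ, (n + 1 : ℝ≥0∞) * φ n := by
  rw [← tsum_antidiagonal fun p => φ (p.1 + p.2)]
  refine tsum_congr fun n => ?_
  rw [Finset.sum_congr rfl (g := fun _ => φ n) fun p hp => by
    rw [Finset.HasAntidiagonal.mem_antidiagonal.mp hp]]
  rw [Finset.sum_const, Finset.Nat.card_antidiagonal, nsmul_eq_mul, Nat.cast_succ]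

/-- There are `n + 1` words of length `n`, and `n + 1 ≤ √t e^{n/√t}`. -/
theorem tsum_word_le {ε t : ℝ} (ht : 1 ≤ t) (φ : ℕ → ℝ≥0∞) :
    ∑' p : ℕ × ℕ, φ (p.1 + p.2) * ENNReal.ofReal (Real.exp (ε / √t)) ^ (p.1 + p.2) ≤
      ENNReal.ofReal √t * ∑' n, φ n * ENNReal.ofReal (Real.exp ((ε + 1) / √t)) ^ n := by
  have hst : 1 ≤ √t := Real.one_le_sqrt.mpr ht
  rw [tsum_add_eq fun n => φ n * ENNReal.ofReal (Real.exp (ε / √t)) ^ n, ← ENNReal.tsum_mul_left]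
  refine ENNReal.tsum_le_tsum fun n => ?_
  have h1 : (n + 1 : ℝ≥0∞) ≤ ENNReal.ofReal √t * ENNReal.ofReal (Real.exp (1 / √t)) ^ n := by
    rw [← ENNReal.ofReal_pow (Real.exp_pos _).le, ← Real.exp_nat_mul,
      ← ENNReal.ofReal_mul (Real.sqrt_nonneg t), ← Nat.cast_succ, ← ENNReal.ofReal_natCast]
    refine ENNReal.ofReal_le_ofReal ?_
    calc ((n.succ : ℕ) : ℝ) ≤ n + √t := by
          push_cast
          linarith
      _ = √t * (n * (1 / √t) + 1) := by
          field_simp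
      _ ≤ _ := by
          gcongr
          exact Real.add_one_le_exp _
  calc _ ≤ ENNReal.ofReal √t * ENNReal.ofReal (Real.exp (1 / √t)) ^ n *
        (φ n * ENNReal.ofReal (Real.exp (ε / √t)) ^ n) := mul_le_mul_left h1 _
    _ = _ := by
        rw [add_div, Real.exp_add, ENNReal.ofReal_mul (Real.exp_pos _).le, mul_pow]
        ring

theorem tsum_fst_eq_zero (φ : ℕ → ℝ≥0∞) (z : ℝ≥0∞) :
    ∑' p : ℕ × ℕ, (if p.1 = 0 then φ p.2 else 0) * z ^ (p.1 + p.2) = ∑' n, φ n * z ^ n := by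
  rw [ENNReal.tsum_prod (f := fun i j => (if i = 0 then φ j else 0) * z ^ (i + j)),
    tsum_eq_single 0]
  · simp
  · intro i hi
    simp [hi]

theorem tsum_snd_eq_zero (φ : ℕ → ℝ≥0∞) (z : ℝ≥0∞) :
    ∑' p : ℕ × ℕ, (if p.2 = 0 then φ p.1 else 0) * z ^ (p.1 + p.2) = ∑' n, φ n * z ^ n := by
  rw [← tsum_fst_eq_zero, ← (Equiv.prodComm ℕ ℕ).tsum_eq]
  refine tsum_congr fun p => ?_
  by_cases hp : p.1 = 0 <;> simp [hp, add_comm]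

/-- The coefficients of `e^{-tℒ}` in its word expansion. -/
def heatWord (t : ℝ) (p : ℕ × ℕ) : ℝ := heatCoeff t (p.1 + p.2)

theorem enorm_diffLeft_le (t : ℝ) (p : ℕ × ℕ) : ‖diffLeft (heatWord t) p‖ₑ ≤
    (if p.1 = 0 then ‖heatCoeff t p.2‖ₑ else 0) + ‖heatDiff t (p.1 + p.2)‖ₑ := by
  obtain ⟨_ | a, b⟩ := p
  · simp [diffLeft, heatWord]
  · simp [diffLeft, heatWord, heatDiff, show a + 1 + b - 1 = a + b by omega]

theorem enorm_diffRight_le (t : ℝ) (p : ℕ × ℕ) : ‖diffRight (heatWord t) p‖ₑ ≤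
    (if p.2 = 0 then ‖heatCoeff t p.1‖ₑ else 0) + ‖heatDiff t (p.1 + p.2)‖ₑ := by
  obtain ⟨a, _ | b⟩ := p
  · simp [diffRight, heatWord]
  · simp [diffRight, heatWord, heatDiff, show a + (b + 1) - 1 = a + b by omega]

theorem enorm_diffRight_diffLeft_le (t : ℝ) (p : ℕ × ℕ) :
    ‖diffRight (diffLeft (heatWord t)) p‖ₑ ≤ (if p.1 = 0 then ‖heatDiff t p.2‖ₑ else 0) +
      (if p.2 = 0 then ‖heatDiff t p.1‖ₑ else 0) + ‖heatDiff₂ t (p.1 + p.2)‖ₑ := by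
  obtain ⟨_ | a, _ | b⟩ := p
  · refine le_add_right (le_add_right ?_)
    simp [diffRight, diffLeft, heatWord, heatDiff]
  · simp [diffRight, diffLeft, heatWord, heatDiff]
  · simp [diffRight, diffLeft, heatWord, heatDiff]
  · have h : diffRight (diffLeft (heatWord t)) (a + 1, b + 1) = heatDiff₂ t (a + 1 + (b + 1)) := by
      simp [diffRight, diffLeft, heatWord, heatDiff₂, heatDiff,
        show a + 1 + (b + 1) - 1 = a + b + 1 by omega, show a + (b + 1) = a + b + 1 by omega,
        show a + 1 + b = a + b + 1 by omega]
    rw [h]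
    simp

/-- On a diagonal `a - b = const` there is at most one word with `a = 0`, and at most one word of
each length. -/
theorem tsum_diagonal_le (t : ℝ) (δ : ℤ) :
    ∑' p : {p : ℕ × ℕ // (p.1 : ℤ) - p.2 = δ}, ‖diffLeft (heatWord t) p‖ₑ ≤
      2 * ∑' k, ‖heatDiff t k‖ₑ := by
  have h0 : ∀ p : {p : ℕ × ℕ // (p.1 : ℤ) - p.2 = δ}, ‖diffLeft (heatWord t) p.1‖ₑ ≤
      (if p.1.1 = 0 then ‖heatCoeff t p.1.2‖ₑ else 0) + ‖heatDiff t (p.1.1 + p.1.2)‖ₑ :=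
    fun p => enorm_diffLeft_le t p.1
  refine (ENNReal.tsum_le_tsum h0).trans ?_
  rw [ENNReal.tsum_add, two_mul]
  refine add_le_add ?_ ?_
  · by_cases h : ∃ p : {p : ℕ × ℕ // (p.1 : ℤ) - p.2 = δ}, p.1.1 = 0
    · obtain ⟨p, hp⟩ := h
      rw [tsum_eq_single p]
      · rw [if_pos hp]
        exact enorm_heatCoeff_le t _
      · intro q hq
        refine if_neg fun hq0 => hq (Subtype.ext (Prod.ext (hq0.trans hp.symm) ?_))
        have h1 := p.2
        have h2 := q.2
        omega
    · push Not at h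
      simp [h]
  · refine ENNReal.tsum_comp_le_tsum_of_injective
      (f := fun p : {p : ℕ × ℕ // (p.1 : ℤ) - p.2 = δ} => p.1.1 + p.1.2) ?_
      fun k => ‖heatDiff t k‖ₑ
    intro p q hpq
    have h1 := p.2
    have h2 := q.2
    simp only at hpq
    exact Subtype.ext (Prod.ext (by omega) (by omega))

theorem diffConst_pos {α : ℝ} {j : ℕ} (hj : j ≠ 0) : 0 < diffConst α j := by
  have : (0 : ℝ) < j := Nat.cast_pos.mpr (Nat.pos_of_ne_zero hj)
  unfold diffConst
  positivity

section WordSums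

variable {ε t : ℝ}

theorem ofReal_exp_div_pow_le (n : ℕ) :
    ENNReal.ofReal (Real.exp (ε / √t)) ^ n ≤ ENNReal.ofReal (Real.exp ((ε + 1) / √t)) ^ n := by
  gcongr
  linarith

theorem tsum_heatWord_le (hε : 0 < ε) (ht : 1 ≤ t) :
    ∑' p : ℕ × ℕ, ‖heatWord t p‖ₑ * ENNReal.ofReal (Real.exp (ε / √t)) ^ (p.1 + p.2) ≤
      ENNReal.ofReal (2 * diffConst (ε + 1) 1) := by
  have hst : 0 < √t := Real.sqrt_pos.mpr (by linarith)
  refine (tsum_word_le ht fun n => ‖heatCoeff t n‖ₑ).trans ?_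
  refine (mul_le_mul_right (tsum_enorm_heatCoeff_le (by linarith) ht) _).trans_eq ?_
  rw [← ENNReal.ofReal_mul hst.le, mul_div_cancel₀ _ hst.ne']

theorem tsum_heatDiff_word_le (hε : 0 < ε) (ht : 1 ≤ t) :
    ∑' p : ℕ × ℕ, ‖heatDiff t (p.1 + p.2)‖ₑ *
        ENNReal.ofReal (Real.exp (ε / √t)) ^ (p.1 + p.2) ≤
      ENNReal.ofReal (2 * diffConst (ε + 1) 2 / √t) := by
  have hst : 0 < √t := Real.sqrt_pos.mpr (by linarith)
  refine (tsum_word_le ht fun n => ‖heatDiff t n‖ₑ).trans ?_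
  refine (mul_le_mul_right (tsum_enorm_heatDiff_le (by linarith) ht) _).trans_eq ?_
  rw [← ENNReal.ofReal_mul hst.le]
  congr 1
  nth_rw 2 [← Real.sq_sqrt (show 0 ≤ t by linarith)]
  field_simp

theorem tsum_heatDiff₂_word_le (hε : 0 < ε) (ht : 1 ≤ t) :
    ∑' p : ℕ × ℕ, ‖heatDiff₂ t (p.1 + p.2)‖ₑ *
        ENNReal.ofReal (Real.exp (ε / √t)) ^ (p.1 + p.2) ≤
      ENNReal.ofReal (2 * diffConst (ε + 1) 3 / t) := by
  have hst : 0 < √t := Real.sqrt_pos.mpr (by linarith)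
  refine (tsum_word_le ht fun n => ‖heatDiff₂ t n‖ₑ).trans ?_
  refine (mul_le_mul_right (tsum_enorm_heatDiff₂_le (by linarith) ht) _).trans_eq ?_
  rw [← ENNReal.ofReal_mul hst.le]
  congr 1
  nth_rw 3 [← Real.sq_sqrt (show 0 ≤ t by linarith)]
  field_simp

theorem tsum_heatCoeff_boundary_le (hε : 0 < ε) (ht : 1 ≤ t) :
    ∑' n, ‖heatCoeff t n‖ₑ * ENNReal.ofReal (Real.exp (ε / √t)) ^ n ≤
      ENNReal.ofReal (2 * diffConst (ε + 1) 1 / √t) :=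
  (ENNReal.tsum_le_tsum fun n => mul_le_mul_right (ofReal_exp_div_pow_le n) _).trans
    (tsum_enorm_heatCoeff_le (by linarith) ht)

theorem tsum_heatDiff_boundary_le (hε : 0 < ε) (ht : 1 ≤ t) :
    ∑' n, ‖heatDiff t n‖ₑ * ENNReal.ofReal (Real.exp (ε / √t)) ^ n ≤
      ENNReal.ofReal (2 * diffConst (ε + 1) 2 / t) :=
  (ENNReal.tsum_le_tsum fun n => mul_le_mul_right (ofReal_exp_div_pow_le n) _).trans
    (tsum_enorm_heatDiff_le (by linarith) ht)

theorem tsum_diffLeft_le (hε : 0 < ε) (ht : 1 ≤ t) :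
    ∑' p : ℕ × ℕ, ‖diffLeft (heatWord t) p‖ₑ *
        ENNReal.ofReal (Real.exp (ε / √t)) ^ (p.1 + p.2) ≤
      ENNReal.ofReal ((2 * diffConst (ε + 1) 1 + 2 * diffConst (ε + 1) 2) / √t) := by
  have h1 : 0 < diffConst (ε + 1) 1 := diffConst_pos one_ne_zero
  have h2 : 0 < diffConst (ε + 1) 2 := diffConst_pos two_ne_zero
  refine (ENNReal.tsum_le_tsum fun p => mul_le_mul_left (enorm_diffLeft_le t p) _).trans ?_
  simp_rw [add_mul]
  rw [ENNReal.tsum_add, tsum_fst_eq_zero (fun n => ‖heatCoeff t n‖ₑ), add_div,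
    ENNReal.ofReal_add (by positivity) (by positivity)]
  exact add_le_add (tsum_heatCoeff_boundary_le hε ht) (tsum_heatDiff_word_le hε ht)

theorem tsum_diffRight_le (hε : 0 < ε) (ht : 1 ≤ t) :
    ∑' p : ℕ × ℕ, ‖diffRight (heatWord t) p‖ₑ *
        ENNReal.ofReal (Real.exp (ε / √t)) ^ (p.1 + p.2) ≤
      ENNReal.ofReal ((2 * diffConst (ε + 1) 1 + 2 * diffConst (ε + 1) 2) / √t) := by
  have h1 : 0 < diffConst (ε + 1) 1 := diffConst_pos one_ne_zero
  have h2 : 0 < diffConst (ε + 1) 2 := diffConst_pos two_ne_zero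
  refine (ENNReal.tsum_le_tsum fun p => mul_le_mul_left (enorm_diffRight_le t p) _).trans ?_
  simp_rw [add_mul]
  rw [ENNReal.tsum_add, tsum_snd_eq_zero (fun n => ‖heatCoeff t n‖ₑ), add_div,
    ENNReal.ofReal_add (by positivity) (by positivity)]
  exact add_le_add (tsum_heatCoeff_boundary_le hε ht) (tsum_heatDiff_word_le hε ht)

theorem tsum_diffRight_diffLeft_le (hε : 0 < ε) (ht : 1 ≤ t) :
    ∑' p : ℕ × ℕ, ‖diffRight (diffLeft (heatWord t)) p‖ₑ *
        ENNReal.ofReal (Real.exp (ε / √t)) ^ (p.1 + p.2) ≤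
      ENNReal.ofReal ((2 * diffConst (ε + 1) 2 + 2 * diffConst (ε + 1) 2 +
        2 * diffConst (ε + 1) 3) / t) := by
  have h2 : 0 < diffConst (ε + 1) 2 := diffConst_pos two_ne_zero
  have h3 : 0 < diffConst (ε + 1) 3 := diffConst_pos three_ne_zero
  refine (ENNReal.tsum_le_tsum fun p =>
    mul_le_mul_left (enorm_diffRight_diffLeft_le t p) _).trans ?_
  simp_rw [add_mul]
  rw [ENNReal.tsum_add, ENNReal.tsum_add, tsum_fst_eq_zero (fun n => ‖heatDiff t n‖ₑ),
    tsum_snd_eq_zero (fun n => ‖heatDiff t n‖ₑ), add_div, add_div,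
    ENNReal.ofReal_add (by positivity) (by positivity),
    ENNReal.ofReal_add (by positivity) (by positivity)]
  exact add_le_add (add_le_add (tsum_heatDiff_boundary_le hε ht)
    (tsum_heatDiff_boundary_le hε ht)) (tsum_heatDiff₂_word_le hε ht)

end WordSums

namespace FlowTree

variable {T : Type*} [MeasurableSpace T] [DiscreteMeasurableSpace T] (F : FlowTree T)

theorem hasSum_gradient_mul_heat (t : ℝ) :
    HasSum (fun p => (diffLeft (heatWord t) p : ℂ) • F.word p) (F.gradient * F.heat t) :=
  hasSum_gradient_mul (F.hasSum_heat t)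

end FlowTree

end FlowTrees

end

open FlowTrees FlowTrees.FlowTree in
theorem theorem1p4 :
    (∀ ε : ℝ, 0 < ε → ∃ c : ℝ, 0 < c ∧
      ∀ (T : Type*) [MeasurableSpace T] [DiscreteMeasurableSpace T]
        (F : FlowTrees.FlowTree T) (t : ℝ), 1 ≤ t →
        (⨆ y, F.weightedSum ε t (F.kernel (F.heat t)) y) ≤ ENNReal.ofReal c ∧
        (⨆ y, F.weightedSum ε t (F.kernel (F.gradient * F.heat t)) y)
          ≤ ENNReal.ofReal (c / √t) ∧
        (⨆ y, F.weightedSum ε t (F.kernel (F.heat t * F.gradientAdj)) y)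
          ≤ ENNReal.ofReal (c / √t) ∧
        (⨆ y, F.weightedSum ε t (F.kernel (F.gradient * F.heat t * F.gradientAdj)) y)
          ≤ ENNReal.ofReal (c / t)) ∧
    (∃ C : ℝ, 0 < C ∧
      ∀ (T : Type*) [MeasurableSpace T] [DiscreteMeasurableSpace T]
        (F : FlowTrees.FlowTree T) (ℓ : T → ℤ), F.IsLevelFunction ℓ → ∀ t : ℝ, 0 < t →
        (⨆ l : ℤ, ⨆ x, ∑' z : {z // ℓ z = l},
          ENNReal.ofReal (‖F.kernel (F.gradient * F.heat t) x z‖ * F.m z))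
            ≤ ENNReal.ofReal (C / (1 + t)) ∧
        (⨆ l : ℤ, ⨆ x, ∑' z : {z // ℓ z = l},
          ENNReal.ofReal (‖F.kernel (F.gradient * F.heat t) z x‖ * F.m z))
            ≤ ENNReal.ofReal (C / (1 + t))) := by
  refine ⟨fun ε hε => ?_, 128, by norm_num, ?_⟩
  · have h1 : 0 < diffConst (ε + 1) 1 := diffConst_pos one_ne_zero
    have h2 : 0 < diffConst (ε + 1) 2 := diffConst_pos two_ne_zero
    have h3 : 0 < diffConst (ε + 1) 3 := diffConst_pos three_ne_zero
    refine ⟨2 * diffConst (ε + 1) 1 + 4 * diffConst (ε + 1) 2 + 2 * diffConst (ε + 1) 3,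
      by positivity, fun T _ _ F t ht => ⟨?_, ?_, ?_, ?_⟩⟩ <;> refine iSup_le fun y => ?_
    · refine (weightedSum_kernel_le (F.hasSum_heat t) hε.le t y).trans
        ((tsum_heatWord_le hε ht).trans (ENNReal.ofReal_le_ofReal ?_))
      linarith
    · exact (weightedSum_kernel_le (F.hasSum_gradient_mul_heat t) hε.le t y).trans
        ((tsum_diffLeft_le hε ht).trans (ENNReal.ofReal_le_ofReal
          (div_le_div_of_nonneg_right (by linarith) (by positivity))))
    · exact (weightedSum_kernel_le (hasSum_mul_gradientAdj (F.hasSum_heat t)) hε.le t y).trans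
        ((tsum_diffRight_le hε ht).trans (ENNReal.ofReal_le_ofReal
          (div_le_div_of_nonneg_right (by linarith) (by positivity))))
    · exact (weightedSum_kernel_le (hasSum_mul_gradientAdj (F.hasSum_gradient_mul_heat t))
        hε.le t y).trans
        ((tsum_diffRight_diffLeft_le hε ht).trans (ENNReal.ofReal_le_ofReal
          (div_le_div_of_nonneg_right (by linarith) (by positivity))))
  · intro T _ _ F ℓ hℓ t ht
    refine ⟨iSup₂_le fun l x => ?_, iSup₂_le fun l x => ?_⟩
    · exact (tsum_level_right_le (F.hasSum_gradient_mul_heat t) hℓ l x).trans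
        ((tsum_diagonal_le t _).trans (two_mul_tsum_enorm_heatDiff_le ht))
    · exact (tsum_level_left_le (F.hasSum_gradient_mul_heat t) hℓ l x).trans
        ((tsum_diagonal_le t _).trans (two_mul_tsum_enorm_heatDiff_le ht))
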